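/- Theorem 5. There exist universal constants $C_1,C_2,C_3>0$ such that the following holds. Let $d,M\ge1$, let $(A^{(k)},W^{(k)})_{1\le k\le K}$ be pairs of real $d\times d$ matrices with every $W^{(k)}$ symmetric positive definite, and write $\|\cdot\|$ for the spectral norm. Suppose that there are $\kappa_A\ge1$, $0\le\rho<1$, $\Gamma_{\max}>0$, $W_{\min}>0$ and $\kappa_w\ge1$ such that for all $1\le k\le K$ \[ \|(A^{(k)})^t\|\le\kappa_A\rho^t\ (t=1,2,\dots),\qquad \lambda_{\max}(\Gamma^{(k)})\le\Gamma_{\max}\ \text{ for }\ \Gamma^{(k)}:=\sum_{i\ge0}(A^{(k)})^iW^{(k)}((A^{(k)})^i)^\top, \] \[ \lambda_{\min}(W^{(k)})\ge W_{\min},\qquad \lambda_{\max}(W^{(k)})/\lambda_{\min}(W^{(k)})\le\kappa_w . \] For $1\le m\le M$ let $k_m\in\{1,\dots,K\}$ be a fixed label and $T_m\ge1$ a length, and let the trajectory $(x_{m,t})_{0\le t\le T_m}$ in $\mathbb R^d$ obey $x_{m,t+1}=A^{(k_m)}x_{m,t}+w_{m,t}$ for $0\le t\le T_m-1$, where the $w_{m,t}\sim\mathcal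 N(0,W^{(k_m)})$ are independent over all $m$ and $t$. Suppose that one of the following two cases holds: - Case 0: $x_{m,0}=0$ for all $m$; - Case 1: $x_{1,0}=0$, $x_{m+1,0}=x_{m,T_m}$ for $1\le m\le M-1$, and $T_m\ge\frac1{1-\rho}\log(\sqrt2\,\kappa_A)$ for all $1\le m\le M$. Let $0<\delta<1$, $T_{\mathrm{total}}:=\sum_{m=1}^MT_m$ and $\iota:=\log\big(\frac{\Gamma_{\max}}{W_{\min}}\cdot\frac{d\,\kappa_A\,T_{\mathrm{total}}}{\delta}\big)$. Let $\mathcal M_{\mathrm{clustering}},\mathcal M_{\mathrm{classification}}\subseteq\{1,\dots,M\}$ be such that $T_m\ge4$ for all $m\in\mathcal M_{\mathrm{clustering}}\cup\mathcal M_{\mathrm{classification}}$. Let $\mathcal C_1,\dots,\mathcal C_K\subseteq\mathcal M_{\mathrm{clustering}}\cup\mathcal M_{\mathrm{classification}}$ be fixed clusters that are pure, i.e. $k_m=k$ for all $m\in\mathcal C_k$, and suppose that \[ T^{(k)}:=\sum_{m\in\mathcal C_k}T_m\ \ge\ C_1\,d\,\kappa_w^2\,\iota,\qquad 1\le k\le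 K . \] Put \[ \hat A^{(k)}:=\Big(\sum_{m\in\mathcal C_k}\sum_{t=0}^{T_m-1}x_{m,t+1}x_{m,t}^\top\Big)\Big(\sum_{m\in\mathcal C_k}\sum_{t=0}^{T_m-1}x_{m,t}x_{m,t}^\top\Big)^{-1}, \] \[ \hat W^{(k)}:=\frac1{T^{(k)}}\sum_{m\in\mathcal C_k}\sum_{t=0}^{T_m-1}\hat w_{m,t}\hat w_{m,t}^\top,\qquad \hat w_{m,t}:=x_{m,t+1}-\hat A^{(k)}x_{m,t}\quad(m\in\mathcal C_k). \] Then with probability at least $1-\delta$, simultaneously for all $1\le k\le K$, the matrix inverted in $\hat A^{(k)}$ is invertible and \[ \|\hat A^{(k)}-A^{(k)}\|\le C_2\sqrt{\frac{d\,\kappa_w\,\iota}{T^{(k)}}},\qquad \frac{\|\hat W^{(k)}-W^{(k)}\|}{\|W^{(k)}\|}\le C_3\sqrt{\frac{d\,\iota}{T^{(k)}}} . \] -/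

import Mathlib

open MeasureTheory ProbabilityTheory

namespace MixedLDS

/-- State vectors, with the Euclidean norm. -/
abbrev State (d : ℕ) : Type := EuclideanSpace ℝ (Fin d)

/-- The linear map `v ↦ A v` on state vectors. -/
noncomputable def act {d : ℕ} (A : Matrix (Fin d) (Fin d) ℝ) (v : State d) : State d :=
  Matrix.toEuclideanCLM (n := Fin d) (𝕜 := ℝ) A v

/-- The spectral norm of a matrix: its operator norm for the Euclidean norm. -/
noncomputable def specNorm {d : ℕ} (A : Matrix (Fin d) (Fin d) ℝ) : ℝ :=
  ‖Matrix.toEuclideanCLM (n := Fin d) (𝕜 := ℝ) A‖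

/-- The outer product `u vᵀ`. -/
def outer {d : ℕ} (u v : State d) : Matrix (Fin d) (Fin d) ℝ :=
  Matrix.vecMulVec u.ofLp v.ofLp

/-- The largest eigenvalue (used for symmetric matrices of positive size only). -/
noncomputable def lambdaMax {d : ℕ} (S : Matrix (Fin d) (Fin d) ℝ) : ℝ :=
  sSup (spectrum ℝ S)

/-- The smallest eigenvalue (used for symmetric matrices of positive size only). -/
noncomputable def lambdaMin {d : ℕ} (S : Matrix (Fin d) (Fin d) ℝ) : ℝ :=
  sInf (spectrum ℝ S)

/-- The order-0 stationary autocovariance `∑_{i ≥ 0} Aⁱ W (Aⁱ)ᵀ` of a stable system. -/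
noncomputable def autocov {d : ℕ} (A W : Matrix (Fin d) (Fin d) ℝ) : Matrix (Fin d) (Fin d) ℝ :=
  ∑' i : ℕ, A ^ i * W * (A ^ i).transpose

/-- The assumptions on the `K` ground-truth models `(A k, W k)`: exponential stability,
bounded autocovariances, and well-conditioned positive definite noise covariances. -/
structure ModelAssumptions {d K : ℕ} (A W : Fin K → Matrix (Fin d) (Fin d) ℝ)
    (κA ρ Γmax Wmin κw : ℝ) : Prop where
  one_le_κA : 1 ≤ κA
  ρ_nonneg : 0 ≤ ρ
  ρ_lt_one : ρ < 1
  stable : ∀ k, ∀ t : ℕ, 1 ≤ t → specNorm (A k ^ t) ≤ κA * ρ ^ t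
  posDef : ∀ k, (W k).PosDef
  Wmin_pos : 0 < Wmin
  Wmin_le : ∀ k, Wmin ≤ lambdaMin (W k)
  autocov_le : ∀ k, lambdaMax (autocov (A k) (W k)) ≤ Γmax
  one_le_κw : 1 ≤ κw
  cond_le : ∀ k, lambdaMax (W k) / lambdaMin (W k) ≤ κw

/-- The `M` trajectories `x m 0, …, x m (T m)`, with labels `label m` and noise vectors
`w m 0, …, w m (T m - 1)`: the noise vectors are independent (over all `m` and `t`) and Gaussian
with mean zero and covariance `W (label m)`, and drive the linear dynamics. -/
structure IsMixedLDS {d K M : ℕ} (A W : Fin K → Matrix (Fin d) (Fin d) ℝ)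
    (label : Fin M → Fin K) (T : Fin M → ℕ)
    {Ω : Type*} [MeasurableSpace Ω] (P : Measure Ω)
    (w x : Fin M → ℕ → Ω → State d) : Prop where
  noise_law : ∀ m, ∀ t < T m, HasLaw (w m t) (multivariateGaussian 0 (W (label m))) P
  noise_indep : iIndepFun (fun (p : (m : Fin M) × Fin (T m)) => w p.1 (p.2 : ℕ)) P
  dynamics : ∀ m, ∀ t < T m, ∀ ω, x m (t + 1) ω = act (A (label m)) (x m t ω) + w m t ω

/-- Every trajectory starts at the zero state. -/
def StartsAtZero {d M : ℕ} {Ω : Type*} (x : Fin M → ℕ → Ω → State d) : Prop :=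
  ∀ m ω, x m 0 ω = 0

/-- The trajectories are the consecutive segments of one long trajectory that starts at zero. -/
def IsSegmented {d M : ℕ} {Ω : Type*} (T : Fin M → ℕ) (x : Fin M → ℕ → Ω → State d) : Prop :=
  (∀ m : Fin M, (m : ℕ) = 0 → ∀ ω, x m 0 ω = 0) ∧
    ∀ m n : Fin M, (n : ℕ) = (m : ℕ) + 1 → ∀ ω, x n 0 ω = x m (T m) ω

/-- The total length of the trajectories in a cluster. -/
def clusterLength {M : ℕ} (T : Fin M → ℕ) (C : Finset (Fin M)) : ℕ :=
  ∑ m ∈ C, T m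

/-- `∑ x_{m,t} x_{m,t}ᵀ` over `m ∈ C` and `0 ≤ t ≤ T m - 1`. -/
def gram {d M : ℕ} (T : Fin M → ℕ) (y : Fin M → ℕ → State d) (C : Finset (Fin M)) :
    Matrix (Fin d) (Fin d) ℝ :=
  ∑ m ∈ C, ∑ t ∈ Finset.range (T m), outer (y m t) (y m t)

/-- The least-squares estimate of the state transition matrix from the trajectories in `C`. -/
noncomputable def estA {d M : ℕ} (T : Fin M → ℕ) (y : Fin M → ℕ → State d)
    (C : Finset (Fin M)) : Matrix (Fin d) (Fin d) ℝ :=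
  (∑ m ∈ C, ∑ t ∈ Finset.range (T m), outer (y m (t + 1)) (y m t)) * (gram T y C)⁻¹

/-- The estimated noise vector `x_{m,t+1} - Â x_{m,t}`. -/
noncomputable def residual {d M : ℕ} (T : Fin M → ℕ) (y : Fin M → ℕ → State d)
    (C : Finset (Fin M)) (m : Fin M) (t : ℕ) : State d :=
  y m (t + 1) - act (estA T y C) (y m t)

/-- The empirical covariance of the estimated noise vectors. -/
noncomputable def estW {d M : ℕ} (T : Fin M → ℕ) (y : Fin M → ℕ → State d)
    (C : Finset (Fin M)) : Matrix (Fin d) (Fin d) ℝ :=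
  (1 / (clusterLength T C : ℝ)) •
    ∑ m ∈ C, ∑ t ∈ Finset.range (T m), outer (residual T y C m t) (residual T y C m t)

/-- The logarithmic factor `log ((Γmax / Wmin) (d κA Ttotal / δ))`. -/
noncomputable def logFactor (d : ℕ) {M : ℕ} (T : Fin M → ℕ) (κA Γmax Wmin δ : ℝ) : ℝ :=
  Real.log (Γmax / Wmin * (d * κA * (∑ m, T m : ℕ) / δ))

end MixedLDS

namespace MixedLDS

open scoped RealInnerProductSpace ENNReal NNReal

/-! Write `L` for the argument of the logarithm in `logFactor`, `D = d log L`, and for one cluster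
let `n` be its length, `G` its Gram matrix, `s = lambdaMin W` and `τ = ‖W‖`. The normal equations
give `(Â - A) G = ∑ w xᵀ`, so the estimates follow from three facts that hold on one event.

(1) Self-normalized cross terms: `∑ ⟪u, w⟫ ⟪z, x⟫` is at most of order `√(D τ (∑ ⟪z, x⟫² + ν
‖z‖²))`, uniformly in unit `u` and arbitrary `z`. In the lexicographic order of trajectories and
times the states are predictable, so `exp (⟪u, w⟫ c - τ c² / 2)` with `c = ⟪z, x⟫` has conditional
mean at most one. The product over all times then has mean at most one, and Markov's inequality
gives the bound for fixed `u`, `z`. Optimizing the length of `z` produces the square root. (2) The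
empirical covariance of the true noise deviates from `W` by at most order `τ √(D / n)`: the same
argument with exponential moments of squared Gaussians. (3) `G ≥ n s / 4`. Expanding `⟪u, x_{t+1}⟫²
= ⟪u, A x_t + w_t⟫²`, the noise part contributes about `n s` by (2), and (1) shows that the mixed
part cannot cancel it. No stationarity or mixing is needed.

Both (1) and (2) are proved on a net of mesh `L⁻²³`, whose cardinality `L^(25 d)` is beaten by the
Chernoff factor `L^(-60 d)`. Passing to all directions costs an additive constant, since noise and
states are polynomially bounded in `L`: Markov's inequality bounds the total noise energy, and
stability bounds the states by the noise. In the segmented case the length condition keeps the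
initial states from compounding. `Γmax` serves only to bound the noise covariances.

Given (1) and (3), duality yields the bound on `Â`. By the normal equations, the residuals lose
exactly `∑ ⟪(Â - A)ᵀ u, x⟫²` of the noise energy in direction `u`, which (1) bounds by order `D τ`;
with (2) this bounds `Ŵ`. A union bound over the clusters, which are disjoint and nonempty, ends the
proof.

The carrying lemmas are `lintegral_prod_adapted_le_one`, `cross_le_sqrt_of_scaled`,
`NetControl.noiseControl`, `gram_lower_bound`, `least_squares_specNorm_le`, `residual_sq_sum_sub_le`
and `norm_state_le`. -/

/-- A finite net of the unit ball, obtained by choosing one point in each cell of a grid. -/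
lemma exists_unit_ball_net (d k : ℕ) (hk : 0 < k) :
    ∃ N : Finset (State d), (∀ u ∈ N, ‖u‖ ≤ 1) ∧ N.card ≤ (2 * k + 1) ^ d ∧
      ∀ u : State d, ‖u‖ ≤ 1 → ∃ v ∈ N, ‖u - v‖ ≤ d / k := by
  classical
  have hk' : (0 : ℝ) < k := by exact_mod_cast hk
  let cell : State d → (Fin d → ℤ) := fun u i => ⌊(k : ℝ) * u i⌋
  let box : Finset (Fin d → ℤ) := Fintype.piFinset fun _ => Finset.Icc (-(k : ℤ)) k
  have hcell : ∀ u : State d, ‖u‖ ≤ 1 → cell u ∈ box := by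
    intro u hu
    rw [Fintype.mem_piFinset]
    intro i
    have h1 : |u i| ≤ 1 := (PiLp.norm_apply_le u i).trans hu
    rw [abs_le] at h1
    rw [Finset.mem_Icc]
    constructor
    · rw [Int.le_floor]; push_cast; nlinarith
    · have : (⌊(k : ℝ) * u i⌋ : ℝ) ≤ k := (Int.floor_le _).trans (by nlinarith)
      exact_mod_cast this
  -- Representatives are taken inside the ball, so net points have norm at most one; the default `0`
  -- for cells missing the ball preserves this.
  let pick : (Fin d → ℤ) → State d := fun c =>
    if h : ∃ u : State d, ‖u‖ ≤ 1 ∧ cell u = c then h.choose else 0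
  have hpick : ∀ c, ‖pick c‖ ≤ 1 := by
    intro c
    by_cases h : ∃ u : State d, ‖u‖ ≤ 1 ∧ cell u = c
    · simp only [pick, dif_pos h]; exact h.choose_spec.1
    · simp [pick, dif_neg h]
  refine ⟨box.image pick, ?_, ?_, ?_⟩
  · intro u hu
    obtain ⟨c, -, rfl⟩ := Finset.mem_image.1 hu
    exact hpick c
  · refine Finset.card_image_le.trans (le_of_eq ?_)
    rw [Fintype.card_piFinset]
    simp only [Int.card_Icc, Finset.prod_const, Finset.card_univ, Fintype.card_fin]
    congr 1
    omega
  · intro u hu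
    refine ⟨pick (cell u), Finset.mem_image_of_mem _ (hcell u hu), ?_⟩
    have h : ∃ v : State d, ‖v‖ ≤ 1 ∧ cell v = cell u := ⟨u, hu, rfl⟩
    have hv : cell (pick (cell u)) = cell u := by
      simp only [pick, dif_pos h]; exact h.choose_spec.2
    set v := pick (cell u)
    have hi : ∀ i, |u i - v i| ≤ 1 / k := by
      intro i
      have h1 := Int.abs_sub_lt_one_of_floor_eq_floor (congrFun hv i)
      rw [← mul_sub, abs_mul, abs_of_pos hk'] at h1
      rw [abs_sub_comm, le_div_iff₀ hk']; linarith
    have h2 : u - v = ∑ i, (u i - v i) • EuclideanSpace.single i (1 : ℝ) := by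
      ext j
      simp [Finset.sum_apply, Pi.single_apply]
    rw [h2]
    refine (norm_sum_le _ _).trans ?_
    calc _ ≤ ∑ _i : Fin d, (1 / k : ℝ) := by
          refine Finset.sum_le_sum fun i _ => ?_
          rw [norm_smul]; simpa using hi i
      _ = d / k := by simp [div_eq_mul_inv]

/-! ### Exponential and second moments of Gaussian vectors -/

lemma inner_act {d : ℕ} (S : Matrix (Fin d) (Fin d) ℝ) (u v : State d) :
    ⟪u, act S v⟫ = u.ofLp ⬝ᵥ S.mulVec v.ofLp :=
  Matrix.inner_toEuclideanCLM S u v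

lemma map_inner_multivariateGaussian {d : ℕ} {S : Matrix (Fin d) (Fin d) ℝ} (hS : S.PosSemidef)
    (u : State d) :
    (multivariateGaussian 0 S).map (fun y => ⟪u, y⟫) = gaussianReal 0 ⟪u, act S u⟫.toNNReal := by
  have h := IsGaussian.map_eq_gaussianReal (μ := multivariateGaussian 0 S) (innerSL ℝ u)
  have h2 : (fun y => ⟪u, y⟫) = (innerSL ℝ u : State d → ℝ) := by ext y; simp
  rw [h2, h, ContinuousLinearMap.integral_comp_id_comm IsGaussian.integrable_id,
    integral_id_multivariateGaussian, map_zero, ← h2,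
    ← covarianceBilin_self IsGaussian.memLp_two_id,
    covarianceBilin_multivariateGaussian hS, ← inner_act]

lemma lintegral_comp_inner_multivariateGaussian {d : ℕ} {S : Matrix (Fin d) (Fin d) ℝ}
    (hS : S.PosSemidef) (u : State d) {f : ℝ → ℝ≥0∞} (hf : Measurable f) :
    ∫⁻ y, f ⟪u, y⟫ ∂(multivariateGaussian 0 S) =
      ∫⁻ t, f t ∂(gaussianReal 0 ⟪u, act S u⟫.toNNReal) := by
  rw [← map_inner_multivariateGaussian hS u, lintegral_map hf (by fun_prop)]

lemma inner_act_self_nonneg {d : ℕ} {S : Matrix (Fin d) (Fin d) ℝ} (hS : S.PosSemidef)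
    (u : State d) : 0 ≤ ⟪u, act S u⟫ := by
  rw [inner_act]; simpa using hS.dotProduct_mulVec_nonneg u.ofLp

lemma lintegral_exp_inner_le_one {d : ℕ} {S : Matrix (Fin d) (Fin d) ℝ} (hS : S.PosSemidef)
    {u : State d} {τ : ℝ} (hu : ⟪u, act S u⟫ ≤ τ) (c : ℝ) :
    ∫⁻ y, ENNReal.ofReal (Real.exp (⟪u, y⟫ * c - τ / 2 * c ^ 2))
      ∂(multivariateGaussian 0 S) ≤ 1 := by
  rw [lintegral_comp_inner_multivariateGaussian hS u
    (f := fun t => ENNReal.ofReal (Real.exp (t * c - τ / 2 * c ^ 2))) (by fun_prop)]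
  have h0 := inner_act_self_nonneg hS u
  have h1 : ∀ t : ℝ, Real.exp (t * c - τ / 2 * c ^ 2) =
      Real.exp (- (τ / 2 * c ^ 2)) * Real.exp (c * t) := by
    intro t; rw [← Real.exp_add]; congr 1; ring
  simp_rw [h1]
  rw [← ofReal_integral_eq_lintegral_ofReal
    ((integrable_exp_mul_gaussianReal c).const_mul _) (ae_of_all _ fun t => by positivity),
    integral_const_mul]
  have h2 := congrFun (mgf_id_gaussianReal (μ := 0) (v := ⟪u, act S u⟫.toNNReal)) c
  simp only [mgf, id] at h2
  rw [h2, ← Real.exp_add, Real.coe_toNNReal _ h0]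
  rw [← ENNReal.ofReal_one]
  refine ENNReal.ofReal_le_ofReal ?_
  rw [Real.exp_le_one_iff]
  nlinarith [sq_nonneg c]

lemma log_one_sub_ge {y : ℝ} (hy : |y| ≤ 1 / 2) : -y - 2 * y ^ 2 ≤ Real.log (1 - y) := by
  have h := Real.abs_log_sub_add_sum_range_le (x := y) (by linarith) 1
  simp only [Finset.range_one, Finset.sum_singleton] at h
  have h2 : |y| ^ (1 + 1) / (1 - |y|) ≤ 2 * y ^ 2 := by
    rw [div_le_iff₀ (by linarith), one_add_one_eq_two, sq_abs]; nlinarith [sq_nonneg y]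
  have h3 := (abs_le.1 (h.trans h2)).1
  norm_num at h3
  linarith

/-- For positive variance the Gaussian integral is explicit: `exp (θ t²)` has mean `(1 - 2 θ
v)^(-1/2)`. By `log_one_sub_ge` at `y = 2 θ v` this is at most `exp (θ v + 4 θ² v²)`, and `v ≤ τ`.
Zero variance is separate because there is no density. -/
lemma lintegral_exp_sq_gaussianReal_le_one {v : ℝ≥0} {θ τ : ℝ} (hv : v ≤ τ)
    (hθ : |θ| * τ ≤ 1 / 4) :
    ∫⁻ t, ENNReal.ofReal (Real.exp (θ * (t ^ 2 - v) - 4 * θ ^ 2 * τ ^ 2))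
      ∂(gaussianReal 0 v) ≤ 1 := by
  by_cases hv0 : v = 0
  · subst hv0
    rw [gaussianReal_zero_var, lintegral_dirac]
    rw [← ENNReal.ofReal_one]
    refine ENNReal.ofReal_le_ofReal ?_
    rw [Real.exp_le_one_iff]
    simp only [NNReal.coe_zero, sub_self, mul_zero, zero_pow two_ne_zero]
    nlinarith [mul_nonneg (sq_nonneg θ) (sq_nonneg τ)]
  have hvp : (0 : ℝ) < v := by positivity
  have hx : |θ * v| ≤ 1 / 4 := by
    rw [abs_mul, abs_of_pos hvp]
    exact (mul_le_mul_of_nonneg_left hv (abs_nonneg _)).trans hθ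
  obtain ⟨hx1, hx2⟩ := abs_le.1 hx
  have hb : 0 < 1 / (2 * v) - θ := by
    rw [sub_pos, lt_div_iff₀ (by positivity)]; linarith
  rw [gaussianReal_of_var_ne_zero 0 hv0, lintegral_withDensity_eq_lintegral_mul _
    (measurable_gaussianPDF 0 v) (by fun_prop)]
  have h1 : ∀ t : ℝ, (gaussianPDF 0 v * fun t => ENNReal.ofReal
      (Real.exp (θ * (t ^ 2 - v) - 4 * θ ^ 2 * τ ^ 2))) t =
      ENNReal.ofReal (((√(2 * Real.pi * v))⁻¹ * Real.exp (-(θ * v) - 4 * θ ^ 2 * τ ^ 2)) *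
        Real.exp (-(1 / (2 * v) - θ) * t ^ 2)) := by
    intro t
    rw [Pi.mul_apply, gaussianPDF, gaussianPDFReal, ← ENNReal.ofReal_mul (by positivity)]
    congr 1
    rw [mul_assoc _ (Real.exp _) (Real.exp _), mul_assoc _ (Real.exp _) (Real.exp _),
      ← Real.exp_add, ← Real.exp_add]
    congr 2
    field_simp
    ring
  simp_rw [h1]
  rw [← ofReal_integral_eq_lintegral_ofReal ((integrable_exp_neg_mul_sq hb).const_mul _)
    (ae_of_all _ fun t => by positivity), integral_const_mul, integral_gaussian]
  rw [← ENNReal.ofReal_one]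
  refine ENNReal.ofReal_le_ofReal ?_
  have h2 : (√(2 * Real.pi * v))⁻¹ * √(Real.pi / (1 / (2 * v) - θ)) =
      (√(1 - 2 * (θ * v)))⁻¹ := by
    rw [← Real.sqrt_inv, ← Real.sqrt_mul (by positivity), ← Real.sqrt_inv]
    congr 1
    have : 1 - 2 * (θ * v) ≠ 0 := by linarith
    have h4 : 1 / (2 * v) - θ = (1 - 2 * (θ * v)) / (2 * v) := by field_simp
    rw [h4]
    field_simp
  rw [mul_right_comm, h2, inv_mul_le_iff₀ (Real.sqrt_pos.2 (by linarith)), mul_one]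
  refine Real.le_sqrt_of_sq_le ?_
  rw [← Real.exp_nat_mul, ← Real.le_log_iff_exp_le (by linarith)]
  have h3 := log_one_sub_ge (y := 2 * (θ * v)) (by rw [abs_mul, abs_two]; linarith)
  refine le_trans ?_ h3
  have h5 : (θ * v) ^ 2 ≤ θ ^ 2 * τ ^ 2 := by
    rw [mul_pow]; gcongr
  push_cast
  nlinarith

lemma lintegral_exp_inner_sq_le_one {d : ℕ} {S : Matrix (Fin d) (Fin d) ℝ} (hS : S.PosSemidef)
    {u : State d} {θ τ : ℝ} (hu : ⟪u, act S u⟫ ≤ τ) (hθ : |θ| * τ ≤ 1 / 4) :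
    ∫⁻ y, ENNReal.ofReal (Real.exp (θ * (⟪u, y⟫ ^ 2 - ⟪u, act S u⟫) - 4 * θ ^ 2 * τ ^ 2))
      ∂(multivariateGaussian 0 S) ≤ 1 := by
  have h0 := inner_act_self_nonneg hS u
  rw [lintegral_comp_inner_multivariateGaussian hS u (f := fun t => ENNReal.ofReal
    (Real.exp (θ * (t ^ 2 - ⟪u, act S u⟫) - 4 * θ ^ 2 * τ ^ 2))) (by fun_prop)]
  have h := lintegral_exp_sq_gaussianReal_le_one (v := ⟪u, act S u⟫.toNNReal) (τ := τ) (θ := θ)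
    (by rwa [Real.coe_toNNReal _ h0]) hθ
  rwa [Real.coe_toNNReal _ h0] at h

lemma lintegral_sq_gaussianReal (v : ℝ≥0) :
    ∫⁻ t, ENNReal.ofReal (t ^ 2) ∂(gaussianReal 0 v) = v := by
  have h := variance_id_gaussianReal (μ := 0) (v := v)
  have hm : MemLp id 2 (gaussianReal 0 v) := memLp_id_gaussianReal 2
  rw [variance_of_integral_eq_zero aemeasurable_id (by simp)] at h
  have hi : Integrable (fun t : ℝ => t ^ 2) (gaussianReal 0 v) := hm.integrable_sq
  rw [← ofReal_integral_eq_lintegral_ofReal hi (ae_of_all _ fun t => by positivity)]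
  simp only [id] at h
  rw [h]; simp

lemma lintegral_norm_sq_multivariateGaussian_le {d : ℕ} {S : Matrix (Fin d) (Fin d) ℝ}
    (hS : S.PosSemidef) {τ : ℝ} (hτ : ∀ u : State d, ‖u‖ ≤ 1 → ⟪u, act S u⟫ ≤ τ) :
    ∫⁻ y, ENNReal.ofReal (‖y‖ ^ 2) ∂(multivariateGaussian 0 S) ≤ ENNReal.ofReal (d * τ) := by
  have h1 : ∀ y : State d, ENNReal.ofReal (‖y‖ ^ 2) =
      ∑ i, ENNReal.ofReal (⟪EuclideanSpace.single i (1 : ℝ), y⟫ ^ 2) := by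
    intro y
    rw [← ENNReal.ofReal_sum_of_nonneg fun i _ => sq_nonneg _, EuclideanSpace.norm_sq_eq]
    simp [EuclideanSpace.inner_single_left]
  simp_rw [h1]
  rw [lintegral_finsetSum _ fun i _ => by fun_prop]
  calc _ ≤ ∑ _i : Fin d, ENNReal.ofReal τ := by
        refine Finset.sum_le_sum fun i _ => ?_
        rw [lintegral_comp_inner_multivariateGaussian hS _
          (f := fun t => ENNReal.ofReal (t ^ 2)) (by fun_prop), lintegral_sq_gaussianReal]
        exact ENNReal.ofReal_le_ofReal (hτ _ (by simp))
    _ = ENNReal.ofReal (d * τ) := by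
        rw [Finset.sum_const, Finset.card_univ, Fintype.card_fin, nsmul_eq_mul,
          ENNReal.ofReal_mul (by positivity), ENNReal.ofReal_natCast]

/-! ### Exponential supermartingales on a finite product space -/

section Supermartingale

variable {I O E : Type*} [Fintype I] [DecidableEq I] [LinearOrder O] [MeasurableSpace E]

/-- Fubini in one coordinate of a finite product of probability measures. -/
lemma lintegral_pi_eq_lintegral_update (μ : I → Measure E) [∀ i, IsProbabilityMeasure (μ i)]
    (a : I) {f : (I → E) → ℝ≥0∞} (hf : Measurable f) :
    ∫⁻ ω, f ω ∂(Measure.pi μ) =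
      ∫⁻ ω, ∫⁻ y, f (Function.update ω a y) ∂(μ a) ∂(Measure.pi μ) := by
  refine lintegral_eq_of_lmarginal_eq {a} hf ?_ ?_
  · rw [← lmarginal_singleton]
    exact hf.lmarginal μ
  · ext ω
    rw [lmarginal_singleton, lmarginal_singleton]
    simp

/-- The product of sequentially adapted factors with conditional expectations at most one
has expectation at most one. -/
lemma lintegral_prod_adapted_le_one (μ : I → Measure E) [∀ i, IsProbabilityMeasure (μ i)]
    (key : I → O) (hkey : Function.Injective key) (h : I → (I → E) → ℝ≥0∞)
    (hm : ∀ p, Measurable (h p))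
    (hdep : ∀ p ω ω', (∀ q, key q ≤ key p → ω q = ω' q) → h p ω = h p ω') (s : Finset I)
    (hone : ∀ p ∈ s, ∀ ω, ∫⁻ y, h p (Function.update ω p y) ∂(μ p) ≤ 1) :
    ∫⁻ ω, ∏ p ∈ s, h p ω ∂(Measure.pi μ) ≤ 1 := by
  -- The latest coordinate is integrated out first: the remaining factors do not depend on it, and
  -- its own factor has integral at most one for every fixed past.
  induction s using Finset.induction_on_max_value key with
  | empty => simp
  | insert a s ha hmax ih =>
    have hma : Measurable fun ω => ∏ p ∈ insert a s, h p ω :=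
      Finset.measurable_prod _ fun p _ => hm p
    rw [lintegral_pi_eq_lintegral_update μ a hma]
    refine le_trans (lintegral_mono fun ω => ?_)
      (ih fun p hp => hone p (Finset.mem_insert_of_mem hp))
    have h1 : ∀ y, ∏ p ∈ insert a s, h p (Function.update ω a y) =
        h a (Function.update ω a y) * ∏ p ∈ s, h p ω := by
      intro y
      rw [Finset.prod_insert ha]
      congr 1
      refine Finset.prod_congr rfl fun p hp => hdep p _ _ fun q hq => ?_
      refine Function.update_of_ne ?_ _ _
      rintro rfl
      exact ha (hkey (le_antisymm (hmax p hp) hq) ▸ hp)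
    simp_rw [h1]
    rw [lintegral_mul_const _ (show Measurable fun y => h a (Function.update ω a y) from
      (hm a).comp (measurable_update ω))]
    exact mul_le_of_le_one_left' (hone a (Finset.mem_insert_self a s) ω)

/-- The Chernoff bound for sums of sequentially adapted exponents. -/
lemma measure_pi_le_of_adapted (μ : I → Measure E) [∀ i, IsProbabilityMeasure (μ i)]
    (key : I → O) (hkey : Function.Injective key) (g : I → (I → E) → ℝ)
    (hm : ∀ p, Measurable (g p))
    (hdep : ∀ p ω ω', (∀ q, key q ≤ key p → ω q = ω' q) → g p ω = g p ω') (s : Finset I)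
    (hone : ∀ p ∈ s, ∀ ω, ∫⁻ y, ENNReal.ofReal (Real.exp (g p (Function.update ω p y)))
      ∂(μ p) ≤ 1) (ℓ : ℝ) :
    Measure.pi μ {ω | ℓ ≤ ∑ p ∈ s, g p ω} ≤ ENNReal.ofReal (Real.exp (-ℓ)) := by
  have h1 := lintegral_prod_adapted_le_one μ key hkey
    (fun p ω => ENNReal.ofReal (Real.exp (g p ω)))
    (fun p => (Real.measurable_exp.comp (hm p)).ennreal_ofReal)
    (fun p ω ω' h => by rw [hdep p ω ω' h]) s hone
  have h2 : ∀ ω, ∏ p ∈ s, ENNReal.ofReal (Real.exp (g p ω)) =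
      ENNReal.ofReal (Real.exp (∑ p ∈ s, g p ω)) := by
    intro ω
    rw [← ENNReal.ofReal_prod_of_nonneg fun p _ => (Real.exp_pos _).le, Real.exp_sum]
  simp_rw [h2] at h1
  have hms : Measurable fun ω => ∑ p ∈ s, g p ω := Finset.measurable_sum _ fun p _ => hm p
  have h3 := meas_ge_le_lintegral_div (μ := Measure.pi μ)
    (f := fun ω => ENNReal.ofReal (Real.exp (∑ p ∈ s, g p ω)))
    (Real.measurable_exp.comp hms).ennreal_ofReal.aemeasurable
    (ε := ENNReal.ofReal (Real.exp ℓ)) (by simp [Real.exp_pos]) ENNReal.ofReal_ne_top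
  have h4 : {ω | ℓ ≤ ∑ p ∈ s, g p ω} =
      {ω | ENNReal.ofReal (Real.exp ℓ) ≤ ENNReal.ofReal (Real.exp (∑ p ∈ s, g p ω))} := by
    ext ω
    simp only [Set.mem_ofPred_eq]
    rw [ENNReal.ofReal_le_ofReal_iff (Real.exp_pos _).le, Real.exp_le_exp]
  rw [h4]
  refine h3.trans ((ENNReal.div_le_div_right h1 _).trans ?_)
  rw [Real.exp_neg, ENNReal.ofReal_inv_of_pos (Real.exp_pos _), one_div]

end Supermartingale

/-! ### Tail bounds for fixed directions -/

section Tails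

variable {I : Type*} [Fintype I] {d : ℕ}

/-- Tail bound for the martingale `∑ ⟪u, w_p⟫ ⟪z, x_p⟫` with predictable `x`. -/
lemma measure_cross_le [DecidableEq I] {O : Type*} [LinearOrder O]
    (S : I → Matrix (Fin d) (Fin d) ℝ) (hS : ∀ p, (S p).PosSemidef)
    (key : I → O) (hkey : Function.Injective key) (F : I → (I → State d) → State d)
    (hF : ∀ p, Measurable (F p))
    (hdep : ∀ p ω ω', (∀ q, key q < key p → ω q = ω' q) → F p ω = F p ω') (s : Finset I)
    (u z : State d) {τ : ℝ} (hu : ∀ p ∈ s, ⟪u, act (S p) u⟫ ≤ τ) (ℓ : ℝ) :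
    Measure.pi (fun p => multivariateGaussian 0 (S p))
      {ω | ℓ + τ / 2 * ∑ p ∈ s, ⟪z, F p ω⟫ ^ 2 ≤ ∑ p ∈ s, ⟪u, ω p⟫ * ⟪z, F p ω⟫} ≤
      ENNReal.ofReal (Real.exp (-ℓ)) := by
  have h := measure_pi_le_of_adapted (fun p => multivariateGaussian 0 (S p)) key hkey
    (fun p ω => ⟪u, ω p⟫ * ⟪z, F p ω⟫ - τ / 2 * ⟪z, F p ω⟫ ^ 2)
    (fun p => by have := hF p; fun_prop)
    (fun p ω ω' h => by rw [h p le_rfl, hdep p ω ω' fun q hq => h q hq.le]) s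
    (fun p hp ω => ?_) ℓ
  · refine le_trans (measure_mono fun ω hω => ?_) h
    simp only [Set.mem_ofPred_eq] at hω ⊢
    rw [Finset.sum_sub_distrib, ← Finset.mul_sum]
    linarith
  -- Predictability freezes the state while the noise at `p` is integrated, so it acts as the
  -- constant `c` of the Gaussian moment bound.
  · have h1 : ∀ y, F p (Function.update ω p y) = F p ω := fun y =>
      hdep p _ _ fun q hq => Function.update_of_ne (fun h => (h ▸ hq).false) _ _
    simp_rw [h1, Function.update_self]
    exact lintegral_exp_inner_le_one (hS p) (hu p hp) _

/-- Tail bound for the centred empirical second moment of the noise in one direction. -/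
lemma measure_sq_le [DecidableEq I] {O : Type*} [LinearOrder O]
    (S : I → Matrix (Fin d) (Fin d) ℝ) (hS : ∀ p, (S p).PosSemidef)
    (key : I → O) (hkey : Function.Injective key) (s : Finset I)
    (u : State d) {τ θ : ℝ} (hu : ∀ p ∈ s, ⟪u, act (S p) u⟫ ≤ τ) (hθ : |θ| * τ ≤ 1 / 4) (ℓ : ℝ) :
    Measure.pi (fun p => multivariateGaussian 0 (S p))
      {ω | ℓ + 4 * θ ^ 2 * τ ^ 2 * s.card ≤
        θ * ∑ p ∈ s, (⟪u, ω p⟫ ^ 2 - ⟪u, act (S p) u⟫)} ≤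
      ENNReal.ofReal (Real.exp (-ℓ)) := by
  have h := measure_pi_le_of_adapted (fun p => multivariateGaussian 0 (S p)) key hkey
    (fun p ω => θ * (⟪u, ω p⟫ ^ 2 - ⟪u, act (S p) u⟫) - 4 * θ ^ 2 * τ ^ 2)
    (fun p => by fun_prop)
    (fun p ω ω' h => by rw [h p le_rfl]) s
    (fun p hp ω => ?_) ℓ
  · refine le_trans (measure_mono fun ω hω => ?_) h
    simp only [Set.mem_ofPred_eq] at hω ⊢
    rw [Finset.sum_sub_distrib, ← Finset.mul_sum, Finset.sum_const, nsmul_eq_mul]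
    linarith
  · simp_rw [Function.update_self]
    exact lintegral_exp_inner_sq_le_one (hS p) (hu p hp) hθ

/-- Markov's inequality for the total noise energy. -/
lemma measure_energy_le (S : I → Matrix (Fin d) (Fin d) ℝ) (hS : ∀ p, (S p).PosSemidef)
    {γ : ℝ} (hγ : ∀ p, ∀ u : State d, ‖u‖ ≤ 1 → ⟪u, act (S p) u⟫ ≤ γ) {b : ℝ} (hb : 0 < b) :
    Measure.pi (fun p => multivariateGaussian 0 (S p)) {ω | b ≤ ∑ p, ‖ω p‖ ^ 2} ≤
      ENNReal.ofReal (Fintype.card I * (d * γ) / b) := by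
  have h1 : ∫⁻ ω, ENNReal.ofReal (∑ p, ‖ω p‖ ^ 2)
      ∂(Measure.pi fun p => multivariateGaussian 0 (S p)) ≤
      ENNReal.ofReal (Fintype.card I * (d * γ)) := by
    simp_rw [ENNReal.ofReal_sum_of_nonneg fun _ _ => sq_nonneg _]
    rw [lintegral_finsetSum _ fun i _ => by fun_prop]
    calc _ ≤ ∑ _p : I, ENNReal.ofReal (d * γ) := by
          refine Finset.sum_le_sum fun p _ => ?_
          refine le_trans (le_of_eq ?_)
            (lintegral_norm_sq_multivariateGaussian_le (hS p) (hγ p))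
          exact (measurePreserving_eval (fun p => multivariateGaussian 0 (S p)) p).lintegral_comp
            (f := fun y => ENNReal.ofReal (‖y‖ ^ 2)) (by fun_prop)
      _ = _ := by
          rw [Finset.sum_const, Finset.card_univ, nsmul_eq_mul, ← ENNReal.ofReal_natCast,
            ← ENNReal.ofReal_mul (Nat.cast_nonneg _)]
  have h3 := meas_ge_le_lintegral_div (μ := Measure.pi fun p => multivariateGaussian 0 (S p))
    (f := fun ω => ENNReal.ofReal (∑ p, ‖ω p‖ ^ 2))
    (Measurable.aemeasurable (by fun_prop))
    (ε := ENNReal.ofReal b) (by simpa using hb) ENNReal.ofReal_ne_top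
  refine le_trans (measure_mono fun ω hω => ?_) (h3.trans ((ENNReal.div_le_div_right h1 _).trans
    (ENNReal.ofReal_div_of_pos hb).ge))
  exact ENNReal.ofReal_le_ofReal hω

end Tails

/-! ### Algebra of matrices acting on states -/

lemma act_add {d : ℕ} (A : Matrix (Fin d) (Fin d) ℝ) (u v : State d) :
    act A (u + v) = act A u + act A v := map_add _ _ _

lemma act_sub {d : ℕ} (A : Matrix (Fin d) (Fin d) ℝ) (u v : State d) :
    act A (u - v) = act A u - act A v := map_sub _ _ _

lemma act_smul {d : ℕ} (A : Matrix (Fin d) (Fin d) ℝ) (c : ℝ) (u : State d) :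
    act A (c • u) = c • act A u := map_smul _ _ _

lemma act_sum {d : ℕ} {ι : Type*} (A : Matrix (Fin d) (Fin d) ℝ) (s : Finset ι) (f : ι → State d) :
    act A (∑ i ∈ s, f i) = ∑ i ∈ s, act A (f i) := map_sum _ _ _

lemma act_mul {d : ℕ} (A B : Matrix (Fin d) (Fin d) ℝ) (u : State d) :
    act (A * B) u = act A (act B u) := by
  simp [act]

lemma act_one {d : ℕ} (u : State d) : act (1 : Matrix (Fin d) (Fin d) ℝ) u = u := by
  simp [act]

lemma matrix_add_act {d : ℕ} (A B : Matrix (Fin d) (Fin d) ℝ) (u : State d) :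
    act (A + B) u = act A u + act B u := by
  simp [act]

lemma matrix_sub_act {d : ℕ} (A B : Matrix (Fin d) (Fin d) ℝ) (u : State d) :
    act (A - B) u = act A u - act B u := by
  simp [act]

lemma matrix_smul_act {d : ℕ} (c : ℝ) (A : Matrix (Fin d) (Fin d) ℝ) (u : State d) :
    act (c • A) u = c • act A u := by
  simp [act]

lemma matrix_sum_act {d : ℕ} {ι : Type*} (s : Finset ι) (A : ι → Matrix (Fin d) (Fin d) ℝ)
    (u : State d) : act (∑ i ∈ s, A i) u = ∑ i ∈ s, act (A i) u := by
  simp [act, map_sum]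

lemma act_outer {d : ℕ} (u v z : State d) : act (outer u v) z = ⟪v, z⟫ • u := by
  ext i
  simp only [act, outer, Matrix.ofLp_toEuclideanCLM, Matrix.vecMulVec_mulVec]
  simp [PiLp.inner_apply, dotProduct, mul_comm]

lemma norm_act_le {d : ℕ} (A : Matrix (Fin d) (Fin d) ℝ) (u : State d) :
    ‖act A u‖ ≤ specNorm A * ‖u‖ := ContinuousLinearMap.le_opNorm _ _

lemma continuous_act {d : ℕ} (A : Matrix (Fin d) (Fin d) ℝ) : Continuous (act A) :=
  (Matrix.toEuclideanCLM (n := Fin d) (𝕜 := ℝ) A).continuous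

lemma specNorm_nonneg {d : ℕ} (A : Matrix (Fin d) (Fin d) ℝ) : 0 ≤ specNorm A := norm_nonneg _

/-! ### Predictability and crude size of the states -/

section Trajectories

variable {d K M : ℕ} {A W : Fin K → Matrix (Fin d) (Fin d) ℝ} {label : Fin M → Fin K}
  {T : Fin M → ℕ}

/-- The position of a noise vector in the lexicographic order of trajectories and times. -/
def timeKey (p : (m : Fin M) × Fin (T m)) : Fin M ×ₗ ℕ := toLex (p.1, (p.2 : ℕ))

lemma timeKey_injective : Function.Injective (timeKey (T := T)) := by
  rintro ⟨m, t⟩ ⟨n, s⟩ h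
  have h' : (m, (t : ℕ)) = (n, (s : ℕ)) := toLex.injective h
  simp only [Prod.mk.injEq] at h'
  obtain ⟨rfl, h2⟩ := h'
  rw [Fin.ext h2]

/-- The states are measurable functions of the earlier noise vectors. -/
lemma exists_predictable {Ω : Type*} {w x : Fin M → ℕ → Ω → State d}
    (hdyn : ∀ m, ∀ t < T m, ∀ ω, x m (t + 1) ω = act (A (label m)) (x m t ω) + w m t ω)
    (hstart : StartsAtZero x ∨ IsSegmented T x) :
    ∃ F : ((m : Fin M) × Fin (T m)) → (((m : Fin M) × Fin (T m)) → State d) → State d,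
      (∀ p, Measurable (F p)) ∧
      (∀ p ω ω', (∀ q, timeKey q < timeKey p → ω q = ω' q) → F p ω = F p ω') ∧
      ∀ p ω, x p.1 p.2 ω = F p fun q => w q.1 q.2 ω := by
  let claim : Fin M → ℕ → Prop := fun m t =>
    ∃ G : (((m : Fin M) × Fin (T m)) → State d) → State d, Measurable G ∧
      (∀ ω ω', (∀ q, timeKey q < toLex (m, t) → ω q = ω' q) → G ω = G ω') ∧
      ∀ ω, x m t ω = G fun q => w q.1 q.2 ω
  have hstep : ∀ m, claim m 0 → ∀ t, t ≤ T m → claim m t := by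
    intro m h0 t
    induction t with
    | zero => exact fun _ => h0
    | succ t ih =>
      intro ht
      obtain ⟨G, hG, hdep, hx⟩ := ih (by omega)
      refine ⟨fun ω => act (A (label m)) (G ω) + ω ⟨m, ⟨t, ht⟩⟩,
        ((continuous_act _).measurable.comp hG).add (measurable_pi_apply _), ?_, ?_⟩
      · intro ω ω' h
        dsimp only
        rw [hdep ω ω' fun q hq => h q (hq.trans (by simp [Prod.Lex.toLex_lt_toLex])),
          h ⟨m, ⟨t, ht⟩⟩ (by simp [timeKey, Prod.Lex.toLex_lt_toLex])]
      · intro ω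
        rw [hdyn m t ht ω, hx ω]
  have hzero : ∀ m, (∀ ω, x m 0 ω = 0) → claim m 0 := fun m h =>
    ⟨fun _ => 0, measurable_const, fun _ _ _ => rfl, h⟩
  have hall : ∀ n : ℕ, ∀ m : Fin M, (m : ℕ) = n → ∀ t, t ≤ T m → claim m t := by
    intro n
    induction n with
    | zero =>
      intro m hm
      refine hstep m (hzero m ?_)
      rcases hstart with h | h
      · exact h m
      · exact h.1 m hm
    | succ n ih =>
      intro m hm
      refine hstep m ?_
      rcases hstart with h | h
      · exact hzero m (h m)
      -- The initial state of a later segment depends on all noise of the preceding segment, which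
      -- is lexicographically before time zero of this one.
      · let m' : Fin M := ⟨n, by omega⟩
        obtain ⟨G, hG, hdep, hx⟩ := ih m' rfl (T m') le_rfl
        refine ⟨G, hG, fun ω ω' hq => hdep ω ω' fun q hlt => hq q (hlt.trans ?_), fun ω => ?_⟩
        · rw [Prod.Lex.toLex_lt_toLex]
          left
          simp only [Fin.lt_def, m']
          omega
        · rw [h.2 m' m (by simp [m', hm]) ω, hx ω]
  choose F hF using fun p : (m : Fin M) × Fin (T m) =>
    hall p.1 p.1 rfl p.2 p.2.2.le
  exact ⟨F, fun p => (hF p).1, fun p => (hF p).2.1, fun p => (hF p).2.2⟩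

/-- The joint law of all noise vectors. -/
lemma IsMixedLDS.map_noise {Ω : Type*} [MeasurableSpace Ω] {P : Measure Ω}
    [IsProbabilityMeasure P] {w x : Fin M → ℕ → Ω → State d}
    (h : IsMixedLDS A W label T P w x) :
    AEMeasurable (fun ω (q : (m : Fin M) × Fin (T m)) => w q.1 q.2 ω) P ∧
    P.map (fun ω (q : (m : Fin M) × Fin (T m)) => w q.1 q.2 ω) =
      Measure.pi fun q : (m : Fin M) × Fin (T m) => multivariateGaussian 0 (W (label q.1)) := by
  have hm : ∀ q : (m : Fin M) × Fin (T m), AEMeasurable (fun ω => w q.1 q.2 ω) P :=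
    fun q => (h.noise_law q.1 q.2 q.2.2).aemeasurable
  refine ⟨aemeasurable_pi_lambda _ hm, ?_⟩
  have h1 := h.noise_indep.map_fun_eq_pi_map hm
  rw [h1]
  congr 1
  ext1 q
  exact (h.noise_law q.1 q.2 q.2.2).map_eq

lemma state_eq_sum {y v : ℕ → State d} {B : Matrix (Fin d) (Fin d) ℝ} {n : ℕ}
    (hdyn : ∀ t < n, y (t + 1) = act B (y t) + v t) {t : ℕ} (ht : t ≤ n) :
    y t = act (B ^ t) (y 0) + ∑ i ∈ Finset.range t, act (B ^ (t - 1 - i)) (v i) := by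
  induction t with
  | zero => simp [act_one]
  | succ t ih =>
    rw [hdyn t ht, ih (by omega), act_add, act_sum, ← act_mul, ← pow_succ', Finset.sum_range_succ,
      add_assoc]
    congr 2
    · refine Finset.sum_congr rfl fun i hi => ?_
      rw [← act_mul, ← pow_succ']
      congr 2
      have := Finset.mem_range.1 hi
      omega
    · simp [act_one]

/-- The factor of the initial state is kept as `specNorm (B ^ t)` instead of `κ`: at the end of a
long segment it is at most one, which prevents a factor `κ` per segment. -/
lemma norm_state_le_of_pow_le {y v : ℕ → State d} {B : Matrix (Fin d) (Fin d) ℝ} {n : ℕ} {κ : ℝ}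
    (hdyn : ∀ t < n, y (t + 1) = act B (y t) + v t) (hB : ∀ t, specNorm (B ^ t) ≤ κ)
    {t : ℕ} (ht : t ≤ n) :
    ‖y t‖ ≤ specNorm (B ^ t) * ‖y 0‖ + κ * ∑ i ∈ Finset.range n, ‖v i‖ := by
  rw [state_eq_sum hdyn ht]
  refine (norm_add_le _ _).trans (add_le_add (norm_act_le _ _) ?_)
  refine (norm_sum_le _ _).trans ?_
  rw [Finset.mul_sum]
  have hκ : 0 ≤ κ := (specNorm_nonneg _).trans (hB 0)
  refine le_trans (Finset.sum_le_sum fun i _ => (norm_act_le _ _).trans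
    (mul_le_mul_of_nonneg_right (hB _) (norm_nonneg _))) ?_
  exact Finset.sum_le_sum_of_subset_of_nonneg (Finset.range_mono ht)
    fun i _ _ => mul_nonneg hκ (norm_nonneg _)

lemma specNorm_one_le : specNorm (1 : Matrix (Fin d) (Fin d) ℝ) ≤ 1 := by
  rw [specNorm, map_one]
  exact ContinuousLinearMap.norm_id_le

/-- A segment that is long enough contracts the initial state. -/
lemma mul_pow_le_one_of_log_le {κ ρ : ℝ} (hκ : 1 ≤ κ) (hρ : 0 ≤ ρ) (hρ1 : ρ < 1) {n : ℕ}
    (hn : 1 / (1 - ρ) * Real.log (Real.sqrt 2 * κ) ≤ n) : κ * ρ ^ n ≤ 1 := by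
  have h1 : ρ ^ n ≤ Real.exp (n * (ρ - 1)) := by
    rw [Real.exp_nat_mul]
    exact pow_le_pow_left₀ hρ (by linarith [Real.add_one_le_exp (ρ - 1)]) n
  rw [one_div, inv_mul_le_iff₀ (by linarith)] at hn
  have h2 : Real.log κ ≤ Real.log (Real.sqrt 2 * κ) :=
    Real.log_le_log (by linarith) (le_mul_of_one_le_left (by linarith)
      (Real.one_le_sqrt.2 (by norm_num)))
  have h3 : Real.exp (n * (ρ - 1)) ≤ κ⁻¹ := by
    rw [← Real.exp_log (show 0 < κ by linarith), ← Real.exp_neg, Real.exp_le_exp]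
    nlinarith
  calc κ * ρ ^ n ≤ κ * κ⁻¹ := by gcongr; exact h1.trans h3
    _ = 1 := mul_inv_cancel₀ (by linarith)

/-- A crude bound on all states by the total noise. -/
lemma norm_state_le {Ω : Type*} {w x : Fin M → ℕ → Ω → State d} {κ ρ : ℝ}
    (hκ : 1 ≤ κ) (hρ : 0 ≤ ρ) (hρ1 : ρ < 1)
    (hA : ∀ k, ∀ t : ℕ, 1 ≤ t → specNorm (A k ^ t) ≤ κ * ρ ^ t) (hT : ∀ m, 1 ≤ T m)
    (hdyn : ∀ m, ∀ t < T m, ∀ ω, x m (t + 1) ω = act (A (label m)) (x m t ω) + w m t ω)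
    (hstart : StartsAtZero x ∨ (IsSegmented T x ∧
      ∀ m, 1 / (1 - ρ) * Real.log (Real.sqrt 2 * κ) ≤ (T m : ℝ)))
    (ω : Ω) (m : Fin M) {t : ℕ} (ht : t ≤ T m) :
    ‖x m t ω‖ ≤ 2 * κ ^ 2 * ∑ q : (m : Fin M) × Fin (T m), ‖w q.1 q.2 ω‖ := by
  have hpow : ∀ k t, specNorm (A k ^ t) ≤ κ := by
    intro k t
    rcases Nat.eq_zero_or_pos t with rfl | h
    · rw [pow_zero]; exact specNorm_one_le.trans hκ
    · exact (hA k t h).trans (mul_le_of_le_one_right (by linarith) (pow_le_one₀ hρ hρ1.le))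
  set h : Fin M → ℝ := fun m => ∑ i ∈ Finset.range (T m), ‖w m i ω‖ with hh
  have hsum : ∑ q : (m : Fin M) × Fin (T m), ‖w q.1 q.2 ω‖ = ∑ m, h m := by
    rw [Fintype.sum_sigma]
    refine Finset.sum_congr rfl fun m _ => ?_
    exact (Finset.sum_range fun i => ‖w m i ω‖).symm
  have h0 : ∀ m, 0 ≤ h m := fun m => Finset.sum_nonneg fun _ _ => norm_nonneg _
  have hstate : ∀ m t, t ≤ T m →
      ‖x m t ω‖ ≤ specNorm (A (label m) ^ t) * ‖x m 0 ω‖ + κ * h m := fun m t ht =>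
    norm_state_le_of_pow_le (y := fun t => x m t ω) (v := fun t => w m t ω)
      (fun t ht => hdyn m t ht ω) (hpow _) ht
  -- Invariant along the segments: initial states grow additively in the earlier noise.
  have hinit : ∀ n : ℕ, ∀ m : Fin M, (m : ℕ) = n →
      ‖x m 0 ω‖ ≤ κ * ∑ j ∈ Finset.univ.filter (· < m), h j := by
    rcases hstart with hz | ⟨hseg, hlong⟩
    · intro n m _
      rw [hz m ω, norm_zero]
      exact mul_nonneg (by linarith) (Finset.sum_nonneg fun j _ => h0 j)
    · intro n
      induction n with
      | zero =>
        intro m hm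
        rw [hseg.1 m hm, norm_zero]
        exact mul_nonneg (by linarith) (Finset.sum_nonneg fun j _ => h0 j)
      | succ n ih =>
        intro m hm
        let m' : Fin M := ⟨n, by omega⟩
        have h1 := ih m' rfl
        have h2 := hstate m' (T m') le_rfl
        have h3 : specNorm (A (label m') ^ T m') ≤ 1 := (hA _ _ (hT m')).trans
          (mul_pow_le_one_of_log_le hκ hρ hρ1 (hlong m'))
        have h4 : Finset.univ.filter (· < m) = insert m' (Finset.univ.filter (· < m')) := by
          ext j
          simp only [Finset.mem_filter, Finset.mem_univ, true_and, Finset.mem_insert, Fin.lt_def,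
            Fin.ext_iff, m']
          omega
        rw [hseg.2 m' m (by simp [m', hm]), h4, Finset.sum_insert (by simp), mul_add]
        nlinarith [norm_nonneg (x m' 0 ω)]
  have h5 := hstate m t ht
  have h6 : ‖x m 0 ω‖ ≤ κ * ∑ j, h j := (hinit m m rfl).trans
    (mul_le_mul_of_nonneg_left (Finset.sum_le_sum_of_subset_of_nonneg (Finset.subset_univ _)
      fun j _ _ => h0 j) (by linarith))
  have h7 : h m ≤ ∑ j, h j := Finset.single_le_sum (fun j _ => h0 j) (Finset.mem_univ m)
  have h8 : 0 ≤ ∑ j, h j := Finset.sum_nonneg fun j _ => h0 j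
  rw [hsum]
  calc ‖x m t ω‖ ≤ κ * (κ * ∑ j, h j) + κ * ∑ j, h j := by
        refine h5.trans (add_le_add (mul_le_mul (hpow _ _) h6 (norm_nonneg _) (by linarith)) ?_)
        gcongr
    _ ≤ κ * (κ * ∑ j, h j) + κ * (κ * ∑ j, h j) := by
        gcongr
        exact le_mul_of_one_le_left h8 hκ
    _ = _ := by ring

end Trajectories

/-! ### Spectral norm, extreme eigenvalues and the autocovariance -/

section Spectral

variable {d : ℕ}

lemma inner_act_transpose (A : Matrix (Fin d) (Fin d) ℝ) (u v : State d) :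
    ⟪u, act A v⟫ = ⟪act A.transpose u, v⟫ := by
  rw [inner_act, real_inner_comm, inner_act, Matrix.mulVec_transpose, Matrix.dotProduct_mulVec,
    dotProduct_comm]

lemma specNorm_transpose (A : Matrix (Fin d) (Fin d) ℝ) : specNorm A.transpose = specNorm A := by
  rw [specNorm, specNorm, ← Matrix.conjTranspose_eq_transpose_of_trivial,
    ← Matrix.star_eq_conjTranspose, map_star]
  exact LinearIsometryEquiv.norm_map ContinuousLinearMap.adjoint _

lemma specNorm_mul_le (A B : Matrix (Fin d) (Fin d) ℝ) :
    specNorm (A * B) ≤ specNorm A * specNorm B := by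
  rw [specNorm, map_mul]; exact norm_mul_le _ _

lemma specNorm_le_of_inner_le {S : Matrix (Fin d) (Fin d) ℝ} {c : ℝ} (hc : 0 ≤ c)
    (h : ∀ u v : State d, ‖u‖ ≤ 1 → ‖v‖ ≤ 1 → ⟪u, act S v⟫ ≤ c) : specNorm S ≤ c := by
  refine ContinuousLinearMap.opNorm_le_of_unit_norm hc fun v hv => ?_
  change ‖act S v‖ ≤ c
  by_cases h0 : act S v = 0
  · rw [h0, norm_zero]; exact hc
  have h1 := h ((‖act S v‖)⁻¹ • act S v) v (by
    rw [norm_smul, norm_inv, norm_norm, inv_mul_cancel₀ (norm_ne_zero_iff.2 h0)]) hv.le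
  rwa [real_inner_smul_left, real_inner_self_eq_norm_sq, pow_two,
    inv_mul_cancel_left₀ (norm_ne_zero_iff.2 h0)] at h1

/-- Polarization writes `4 ⟪u, S v⟫` as the difference of the quadratic form at `u + v` and `u - v`,
and the parallelogram law bounds the sum of the squared norms. -/
lemma specNorm_le_of_abs_inner_self_le {S : Matrix (Fin d) (Fin d) ℝ} (hS : S.transpose = S) {c : ℝ}
    (hc : 0 ≤ c) (h : ∀ u : State d, |⟪u, act S u⟫| ≤ c * ‖u‖ ^ 2) : specNorm S ≤ c := by
  refine specNorm_le_of_inner_le hc fun u v hu hv => ?_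
  have h1 := (abs_le.1 (h (u + v))).2
  have h2 := (abs_le.1 (h (u - v))).1
  have h3 : ⟪v, act S u⟫ = ⟪u, act S v⟫ := by
    rw [inner_act_transpose, hS, real_inner_comm]
  rw [act_add, inner_add_left, inner_add_right, inner_add_right] at h1
  rw [act_sub, inner_sub_left, inner_sub_right, inner_sub_right] at h2
  have h4 := parallelogram_law_with_norm ℝ u v
  have h5 : ‖u‖ ^ 2 ≤ 1 := pow_le_one₀ (norm_nonneg _) hu
  have h6 : ‖v‖ ^ 2 ≤ 1 := pow_le_one₀ (norm_nonneg _) hv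
  nlinarith

lemma inner_act_self_le_specNorm (S : Matrix (Fin d) (Fin d) ℝ) (u : State d) :
    ⟪u, act S u⟫ ≤ specNorm S * ‖u‖ ^ 2 := by
  refine (real_inner_le_norm _ _).trans ?_
  nlinarith [norm_act_le S u, norm_nonneg u]

lemma finite_spectrum {S : Matrix (Fin d) (Fin d) ℝ} (hS : S.IsHermitian) :
    (spectrum ℝ S).Finite := by
  rw [hS.spectrum_real_eq_range_eigenvalues]; exact Set.finite_range _

lemma inner_act_algebraMap (c : ℝ) (u : State d) :
    ⟪u, act (algebraMap ℝ (Matrix (Fin d) (Fin d) ℝ) c) u⟫ = c * ‖u‖ ^ 2 := by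
  rw [Algebra.algebraMap_eq_smul_one, matrix_smul_act, act_one, real_inner_smul_right,
    real_inner_self_eq_norm_sq]

lemma isHermitian_algebraMap (c : ℝ) :
    (algebraMap ℝ (Matrix (Fin d) (Fin d) ℝ) c).IsHermitian := by
  rw [Algebra.algebraMap_eq_smul_one, Matrix.IsHermitian, Matrix.conjTranspose_smul,
    Matrix.conjTranspose_one, star_trivial]

lemma inner_act_self_le_lambdaMax {S : Matrix (Fin d) (Fin d) ℝ} (hS : S.IsHermitian)
    (u : State d) : ⟪u, act S u⟫ ≤ lambdaMax S * ‖u‖ ^ 2 := by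
  have hH : (algebraMap ℝ (Matrix (Fin d) (Fin d) ℝ) (lambdaMax S) - S).IsHermitian :=
    (isHermitian_algebraMap _).sub hS
  have hp : (algebraMap ℝ (Matrix (Fin d) (Fin d) ℝ) (lambdaMax S) - S).PosSemidef := by
    rw [hH.posSemidef_iff_eigenvalues_nonneg]
    intro i
    have h1 : hH.eigenvalues i ∈ spectrum ℝ (algebraMap ℝ (Matrix (Fin d) (Fin d) ℝ)
        (lambdaMax S) - S) := by
      rw [hH.spectrum_real_eq_range_eigenvalues]; exact ⟨i, rfl⟩
    rw [← spectrum.singleton_sub_eq, Set.singleton_sub] at h1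
    obtain ⟨r, hr, h2⟩ := h1
    have h3 : r ≤ lambdaMax S := le_csSup (finite_spectrum hS).bddAbove hr
    simp only [Pi.zero_apply]
    rw [← h2]
    linarith
  have h := inner_act_self_nonneg hp u
  rw [matrix_sub_act, inner_sub_right, inner_act_algebraMap] at h
  linarith

lemma lambdaMin_le_inner_act_self {S : Matrix (Fin d) (Fin d) ℝ} (hS : S.IsHermitian)
    (u : State d) : lambdaMin S * ‖u‖ ^ 2 ≤ ⟪u, act S u⟫ := by
  have hH : (S - algebraMap ℝ (Matrix (Fin d) (Fin d) ℝ) (lambdaMin S)).IsHermitian :=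
    hS.sub (isHermitian_algebraMap _)
  have hp : (S - algebraMap ℝ (Matrix (Fin d) (Fin d) ℝ) (lambdaMin S)).PosSemidef := by
    rw [hH.posSemidef_iff_eigenvalues_nonneg]
    intro i
    have h1 : hH.eigenvalues i ∈ spectrum ℝ (S - algebraMap ℝ (Matrix (Fin d) (Fin d) ℝ)
        (lambdaMin S)) := by
      rw [hH.spectrum_real_eq_range_eigenvalues]; exact ⟨i, rfl⟩
    rw [← spectrum.sub_singleton_eq, Set.sub_singleton] at h1
    obtain ⟨r, hr, h2⟩ := h1
    have h3 : lambdaMin S ≤ r := csInf_le (finite_spectrum hS).bddBelow hr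
    simp only [Pi.zero_apply]
    rw [← h2]
    linarith
  have h := inner_act_self_nonneg hp u
  rw [matrix_sub_act, inner_sub_right, inner_act_algebraMap] at h
  linarith

lemma specNorm_le_lambdaMax (hd : 0 < d) {S : Matrix (Fin d) (Fin d) ℝ} (hS : S.PosSemidef) :
    specNorm S ≤ lambdaMax S := by
  have h1 := inner_act_self_le_lambdaMax hS.isHermitian
  have h2 := fun u : State d => inner_act_self_nonneg hS u
  refine specNorm_le_of_abs_inner_self_le (by
    simpa [Matrix.IsHermitian, Matrix.conjTranspose_eq_transpose_of_trivial] using hS.isHermitian)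
    ?_ fun u => ?_
  · have h := (h2 (EuclideanSpace.single ⟨0, hd⟩ 1)).trans (h1 _)
    simpa using h
  · rw [abs_of_nonneg (h2 u)]; exact h1 u

lemma abs_entry_le_specNorm (S : Matrix (Fin d) (Fin d) ℝ) (a b : Fin d) :
    |S a b| ≤ specNorm S := by
  have h1 : S a b = ⟪EuclideanSpace.single a (1 : ℝ), act S (EuclideanSpace.single b 1)⟫ := by
    rw [inner_act]; simp
  rw [h1]
  refine (abs_real_inner_le_norm _ _).trans ?_
  have h2 := norm_act_le S (EuclideanSpace.single b 1)
  simpa using h2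

/-- Without summability the `tsum` in `autocov` would be zero and its eigenvalue bound would say
nothing about `W`. Stability gives entrywise geometric domination. -/
lemma summable_autocov {A W : Matrix (Fin d) (Fin d) ℝ} {κ ρ : ℝ} (hκ : 1 ≤ κ) (hρ : 0 ≤ ρ)
    (hρ1 : ρ < 1) (hA : ∀ t : ℕ, 1 ≤ t → specNorm (A ^ t) ≤ κ * ρ ^ t) :
    Summable fun i : ℕ => A ^ i * W * (A ^ i).transpose := by
  have hpow : ∀ i, specNorm (A ^ i) ≤ κ * ρ ^ i := by
    intro i
    rcases Nat.eq_zero_or_pos i with rfl | h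
    · simpa using specNorm_one_le.trans hκ
    · exact hA i h
  have hgeo : Summable fun i : ℕ => κ ^ 2 * specNorm W * (ρ ^ 2) ^ i :=
    (summable_geometric_of_lt_one (sq_nonneg ρ) (by nlinarith)).mul_left _
  refine Pi.summable.2 fun a => Pi.summable.2 fun b => ?_
  refine Summable.of_norm_bounded hgeo fun i => ?_
  rw [Real.norm_eq_abs]
  refine (abs_entry_le_specNorm _ a b).trans ?_
  calc _ ≤ specNorm (A ^ i) * specNorm W * specNorm (A ^ i) := by
        refine (specNorm_mul_le _ _).trans ?_
        rw [specNorm_transpose]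
        exact mul_le_mul_of_nonneg_right (specNorm_mul_le _ _) (specNorm_nonneg _)
    _ ≤ (κ * ρ ^ i) * specNorm W * (κ * ρ ^ i) := by
        have := hpow i
        have := specNorm_nonneg W
        have := specNorm_nonneg (A ^ i)
        gcongr
    _ = _ := by ring

/-- `W` is the term `i = 0` of a series of positive semidefinite matrices. -/
lemma inner_act_self_le_autocov {A W : Matrix (Fin d) (Fin d) ℝ} (hW : W.PosSemidef)
    (hs : Summable fun i : ℕ => A ^ i * W * (A ^ i).transpose) (u : State d) :
    ⟪u, act W u⟫ ≤ ⟪u, act (autocov A W) u⟫ := by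
  let q : Matrix (Fin d) (Fin d) ℝ →+ ℝ :=
    { toFun := fun S => ⟪u, act S u⟫
      map_zero' := by simp [act]
      map_add' := fun S S' => by rw [matrix_add_act, inner_add_right] }
  have hq : Continuous q := by
    change Continuous fun S => ⟪u, act S u⟫
    simp_rw [inner_act]
    fun_prop
  have h := hs.hasSum.map q hq
  have h1 := le_hasSum h 0 fun i _ => ?_
  · simpa [q, autocov] using h1
  · refine inner_act_self_nonneg ?_ u
    have := hW.mul_mul_conjTranspose_same (A ^ i)
    rwa [Matrix.conjTranspose_eq_transpose_of_trivial] at this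

lemma isHermitian_autocov {A W : Matrix (Fin d) (Fin d) ℝ} (hW : W.IsHermitian) :
    (autocov A W).IsHermitian := by
  rw [Matrix.IsHermitian, Matrix.conjTranspose_eq_transpose_of_trivial] at *
  rw [autocov, Matrix.transpose_tsum]
  simp [Matrix.transpose_mul, hW, Matrix.mul_assoc]

end Spectral

/-! ### Deterministic analysis of least squares -/

section LeastSquares

variable {d : ℕ} {ι : Type*}

lemma inner_act_sum_outer (s : Finset ι) (x y : ι → State d) (u v : State d) :
    ⟪u, act (∑ p ∈ s, outer (x p) (y p)) v⟫ = ∑ p ∈ s, ⟪u, x p⟫ * ⟪v, y p⟫ := by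
  rw [matrix_sum_act, inner_sum]
  refine Finset.sum_congr rfl fun p _ => ?_
  rw [act_outer, real_inner_smul_right, real_inner_comm, mul_comm]

lemma outer_transpose (u v : State d) : (outer u v).transpose = outer v u :=
  Matrix.transpose_vecMulVec _ _

lemma outer_add_left (u u' v : State d) : outer (u + u') v = outer u v + outer u' v := by
  simp [outer, Matrix.add_vecMulVec]

lemma outer_act_left (A : Matrix (Fin d) (Fin d) ℝ) (u v : State d) :
    outer (act A u) v = A * outer u v := by
  simp [outer, act, Matrix.mul_vecMulVec]

lemma sum_outer_self_transpose (s : Finset ι) (x : ι → State d) :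
    (∑ p ∈ s, outer (x p) (x p)).transpose = ∑ p ∈ s, outer (x p) (x p) := by
  rw [Matrix.transpose_sum]
  exact Finset.sum_congr rfl fun p _ => outer_transpose _ _

lemma isUnit_sum_outer {s : Finset ι} {x : ι → State d} {g : ℝ} (hg : 0 < g)
    (hG : ∀ u : State d, g * ‖u‖ ^ 2 ≤ ∑ p ∈ s, ⟪u, x p⟫ ^ 2) :
    IsUnit (∑ p ∈ s, outer (x p) (x p)) := by
  refine Matrix.PosDef.isUnit (Matrix.PosDef.of_dotProduct_mulVec_pos ?_ fun v hv => ?_)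
  · rw [Matrix.IsHermitian, Matrix.conjTranspose_eq_transpose_of_trivial, sum_outer_self_transpose]
  · have h := hG (WithLp.toLp 2 v)
    have h1 := inner_act_sum_outer s x x (WithLp.toLp 2 v) (WithLp.toLp 2 v)
    rw [inner_act] at h1
    simp only [star_trivial]
    rw [h1]
    simp_rw [← pow_two]
    refine lt_of_lt_of_le (mul_pos hg (pow_pos (norm_pos_iff.2 ?_) 2)) h
    simpa using hv

variable {s : Finset ι} {x x' w : ι → State d} {A : Matrix (Fin d) (Fin d) ℝ}

lemma least_squares_error_mul (hx : ∀ p ∈ s, x' p = act A (x p) + w p)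
    (hG : IsUnit (∑ p ∈ s, outer (x p) (x p))) :
    ((∑ p ∈ s, outer (x' p) (x p)) * (∑ p ∈ s, outer (x p) (x p))⁻¹ - A) *
      (∑ p ∈ s, outer (x p) (x p)) = ∑ p ∈ s, outer (w p) (x p) := by
  rw [sub_mul, Matrix.mul_assoc, Matrix.nonsing_inv_mul _ ((Matrix.isUnit_iff_isUnit_det _).1 hG),
    Matrix.mul_one, sub_eq_iff_eq_add, Matrix.mul_sum, ← Finset.sum_add_distrib]
  refine Finset.sum_congr rfl fun p hp => ?_
  rw [hx p hp, outer_add_left, outer_act_left, add_comm]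

/-- With `z = G⁻¹ v` the error form `⟪u, Δ v⟫` is the cross term at `(u, z)`, and `∑ ⟪z, x⟫² = ⟪z,
v⟫`. Coercivity of `G` gives `‖z‖ ≤ 1 / g`, hence `⟪z, v⟫ ≤ 1 / g`. -/
lemma least_squares_specNorm_le (hx : ∀ p ∈ s, x' p = act A (x p) + w p) {g β : ℝ} (hg : 0 < g)
    (hβ : 0 ≤ β) (hG : ∀ u : State d, g * ‖u‖ ^ 2 ≤ ∑ p ∈ s, ⟪u, x p⟫ ^ 2)
    (hcross : ∀ u z : State d, ‖u‖ ≤ 1 →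
      ∑ p ∈ s, ⟪u, w p⟫ * ⟪z, x p⟫ ≤ √(β * ∑ p ∈ s, ⟪z, x p⟫ ^ 2)) :
    specNorm ((∑ p ∈ s, outer (x' p) (x p)) * (∑ p ∈ s, outer (x p) (x p))⁻¹ - A) ≤ √(β / g) := by
  have hunit := isUnit_sum_outer hg hG
  have hmul := least_squares_error_mul hx hunit
  set G := ∑ p ∈ s, outer (x p) (x p) with hGdef
  set Δ := (∑ p ∈ s, outer (x' p) (x p)) * G⁻¹ - A
  refine specNorm_le_of_inner_le (Real.sqrt_nonneg _) fun u v hu hv => ?_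
  set z := act G⁻¹ v
  have hGz : act G z = v := by
    rw [← act_mul, Matrix.mul_nonsing_inv _ ((Matrix.isUnit_iff_isUnit_det _).1 hunit), act_one]
  have h1 : ⟪u, act Δ v⟫ = ∑ p ∈ s, ⟪u, w p⟫ * ⟪z, x p⟫ := by
    rw [← inner_act_sum_outer, ← hmul, act_mul, hGz]
  have h2 : ∑ p ∈ s, ⟪z, x p⟫ ^ 2 = ⟪z, v⟫ := by
    rw [← hGz, hGdef, inner_act_sum_outer]
    simp_rw [pow_two]
  rw [h1]
  refine (hcross u z hu).trans (Real.sqrt_le_sqrt ?_)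
  rw [h2, div_eq_mul_inv]
  refine mul_le_mul_of_nonneg_left ?_ hβ
  have h3 := hG z
  have h4 : ⟪z, v⟫ ≤ ‖z‖ := (real_inner_le_norm _ _).trans
    (mul_le_of_le_one_right (norm_nonneg _) hv)
  rw [h2] at h3
  have h5 : ‖z‖ ≤ g⁻¹ := by
    rw [← one_div, le_div_iff₀ hg]
    by_contra hlt
    nlinarith [norm_nonneg z]
  exact h4.trans h5

/-- With `z = (B - A)ᵀ u` the normal equations make the cross term equal to `q = ∑ ⟪z, x⟫²`. The two
energies therefore differ by exactly `q`, and the cross bound reads `q ≤ √(β q)`, so `q ≤ β`. -/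
lemma residual_sq_sum_sub_le (hx : ∀ p ∈ s, x' p = act A (x p) + w p) {g β : ℝ} (hg : 0 < g)
    (hβ : 0 ≤ β) (hG : ∀ u : State d, g * ‖u‖ ^ 2 ≤ ∑ p ∈ s, ⟪u, x p⟫ ^ 2)
    (hcross : ∀ u z : State d, ‖u‖ ≤ 1 →
      ∑ p ∈ s, ⟪u, w p⟫ * ⟪z, x p⟫ ≤ √(β * ∑ p ∈ s, ⟪z, x p⟫ ^ 2))
    {B : Matrix (Fin d) (Fin d) ℝ}
    (hB : B = (∑ p ∈ s, outer (x' p) (x p)) * (∑ p ∈ s, outer (x p) (x p))⁻¹)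
    (u : State d) (hu : ‖u‖ ≤ 1) :
    |∑ p ∈ s, ⟪u, x' p - act B (x p)⟫ ^ 2 - ∑ p ∈ s, ⟪u, w p⟫ ^ 2| ≤ β := by
  have hunit := isUnit_sum_outer hg hG
  have hmul := least_squares_error_mul hx hunit
  rw [← hB] at hmul
  set z := act (B - A).transpose u with hz
  have hinner : ∀ y, ⟪u, act (B - A) y⟫ = ⟪z, y⟫ := fun y => inner_act_transpose _ _ _
  have hq : ∑ p ∈ s, ⟪u, w p⟫ * ⟪z, x p⟫ = ∑ p ∈ s, ⟪z, x p⟫ ^ 2 := by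
    rw [← inner_act_sum_outer, ← hmul, act_mul, hinner, inner_act_sum_outer]
    simp_rw [pow_two]
  have h1 : ∑ p ∈ s, ⟪u, x' p - act B (x p)⟫ ^ 2 =
      ∑ p ∈ s, ⟪u, w p⟫ ^ 2 - ∑ p ∈ s, ⟪z, x p⟫ ^ 2 := by
    have h2 : ∀ p ∈ s, ⟪u, x' p - act B (x p)⟫ ^ 2 =
        ⟪u, w p⟫ ^ 2 - 2 * (⟪u, w p⟫ * ⟪z, x p⟫) + ⟪z, x p⟫ ^ 2 := by
      intro p hp
      have h3 : x' p - act B (x p) = w p - act (B - A) (x p) := by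
        rw [hx p hp, matrix_sub_act]; abel
      rw [h3, inner_sub_right, hinner]; ring
    rw [Finset.sum_congr rfl h2, Finset.sum_add_distrib, Finset.sum_sub_distrib, ← Finset.mul_sum,
      hq]
    ring
  have hc := hcross u z hu
  rw [hq] at hc
  set q := ∑ p ∈ s, ⟪z, x p⟫ ^ 2
  have hq0 : 0 ≤ q := Finset.sum_nonneg fun _ _ => sq_nonneg _
  rw [h1, sub_sub_cancel_left, abs_neg, abs_of_nonneg hq0]
  have h2 := Real.sq_sqrt (mul_nonneg hβ hq0)
  have h3 : q ^ 2 ≤ β * q := by rw [← h2]; gcongr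
  by_contra hlt
  nlinarith

end LeastSquares

/-! ### From a finite net to all directions -/

section NoiseControl

variable {d : ℕ} {I : Type*}

/-- Uniform control of the noise `w` with covariance `W` and of its correlation with the states `x`
over the index set `s`. -/
structure NoiseControl (s : Finset I) (W : Matrix (Fin d) (Fin d) ℝ) (w x : I → State d)
    (Λ ν : ℝ) : Prop where
  cross : ∀ u z : State d, ‖u‖ ≤ 1 → ∑ p ∈ s, ⟪u, w p⟫ * ⟪z, x p⟫ ≤
    √(2 * Λ * specNorm W * (∑ p ∈ s, ⟪z, x p⟫ ^ 2 + ν * ‖z‖ ^ 2))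
  square : ∀ u : State d, ‖u‖ ≤ 1 →
    |∑ p ∈ s, ⟪u, w p⟫ ^ 2 - s.card * ⟪u, act W u⟫| ≤ 6 * specNorm W * √(Λ * s.card)

/-- The bounds that hold on a finite net `N` with high probability. -/
structure NetControl (N : Finset (State d)) (s : Finset I) (W : Matrix (Fin d) (Fin d) ℝ)
    (w x : I → State d) (R θ ℓ : ℝ) : Prop where
  cross : ∀ u ∈ N, ∀ v ∈ N, ∑ p ∈ s, ⟪u, w p⟫ * ⟪R • v, x p⟫ ≤
    ℓ + specNorm W / 2 * ∑ p ∈ s, ⟪R • v, x p⟫ ^ 2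
  square : ∀ u ∈ N, θ * |∑ p ∈ s, ⟪u, w p⟫ ^ 2 - s.card * ⟪u, act W u⟫| ≤
    ℓ + 4 * θ ^ 2 * specNorm W ^ 2 * s.card

lemma inner_act_self_le_specNorm_of_norm_le_one (S : Matrix (Fin d) (Fin d) ℝ) {u : State d}
    (hu : ‖u‖ ≤ 1) : ⟪u, act S u⟫ ≤ specNorm S :=
  (inner_act_self_le_specNorm S u).trans
    (mul_le_of_le_one_right (specNorm_nonneg S) (pow_le_one₀ (norm_nonneg u) hu))

/-- Union bound over `|N|²` pairs for the cross terms and over `2 |N|` one-sided events for the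
squares, with `|N| ≤ |N|²`. -/
lemma measure_not_netControl_le [Fintype I] [DecidableEq I] {O : Type*} [LinearOrder O]
    (S : I → Matrix (Fin d) (Fin d) ℝ) (hS : ∀ p, (S p).PosSemidef)
    (key : I → O) (hkey : Function.Injective key) (F : I → (I → State d) → State d)
    (hF : ∀ p, Measurable (F p))
    (hdep : ∀ p ω ω', (∀ q, key q < key p → ω q = ω' q) → F p ω = F p ω') (s : Finset I)
    {W : Matrix (Fin d) (Fin d) ℝ} (hW : ∀ p ∈ s, S p = W) {N : Finset (State d)}
    (hN : ∀ u ∈ N, ‖u‖ ≤ 1) (R ℓ : ℝ) {θ : ℝ} (hθ0 : 0 ≤ θ) (hθ : θ * specNorm W ≤ 1 / 4) :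
    Measure.pi (fun p => multivariateGaussian 0 (S p))
      {ω | ¬ NetControl N s W ω (fun p => F p ω) R θ ℓ} ≤
      ENNReal.ofReal (3 * N.card ^ 2 * Real.exp (-ℓ)) := by
  set μ := Measure.pi fun p => multivariateGaussian 0 (S p)
  set e := ENNReal.ofReal (Real.exp (-ℓ)) with he
  let B1 : State d × State d → Set (I → State d) := fun uv =>
    {ω | ℓ + specNorm W / 2 * ∑ p ∈ s, ⟪R • uv.2, F p ω⟫ ^ 2 ≤
      ∑ p ∈ s, ⟪uv.1, ω p⟫ * ⟪R • uv.2, F p ω⟫}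
  let B2 : ℝ → State d → Set (I → State d) := fun θ u =>
    {ω | ℓ + 4 * θ ^ 2 * specNorm W ^ 2 * s.card ≤
        θ * ∑ p ∈ s, (⟪u, ω p⟫ ^ 2 - ⟪u, act (S p) u⟫)}
  have hu : ∀ u ∈ N, ∀ p ∈ s, ⟪u, act (S p) u⟫ ≤ specNorm W := fun u hu p hp => by
    rw [hW p hp]; exact inner_act_self_le_specNorm_of_norm_le_one W (hN u hu)
  have h1 : ∀ uv ∈ N ×ˢ N, μ (B1 uv) ≤ e := fun uv huv =>
    measure_cross_le S hS key hkey F hF hdep s uv.1 (R • uv.2)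
      (hu _ (Finset.mem_product.1 huv).1) ℓ
  have h2 : ∀ u ∈ N, μ (B2 θ u) ≤ e := fun u hu' =>
    measure_sq_le S hS key hkey s u (hu u hu') (by rwa [abs_of_nonneg hθ0]) ℓ
  have h3 : ∀ u ∈ N, μ (B2 (-θ) u) ≤ e := fun u hu' =>
    measure_sq_le S hS key hkey s u (hu u hu') (by rwa [abs_neg, abs_of_nonneg hθ0]) ℓ
  have hsub : {ω | ¬ NetControl N s W ω (fun p => F p ω) R θ ℓ} ⊆
      (⋃ uv ∈ N ×ˢ N, B1 uv) ∪ ((⋃ u ∈ N, B2 θ u) ∪ ⋃ u ∈ N, B2 (-θ) u) := by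
    intro ω hω
    by_contra hno
    simp only [Set.mem_union, Set.mem_iUnion, not_or, not_exists] at hno
    refine hω ⟨fun u hu v hv => ?_, fun u hu' => ?_⟩
    · have h := hno.1 (u, v) (Finset.mk_mem_product hu hv)
      simp only [B1, Set.mem_ofPred_eq, not_le] at h
      exact h.le
    · have h4 := hno.2.1 u hu'
      have h5 := hno.2.2 u hu'
      simp only [B2, Set.mem_ofPred_eq, not_le] at h4 h5
      have h6 : ∑ p ∈ s, (⟪u, ω p⟫ ^ 2 - ⟪u, act (S p) u⟫) =
          ∑ p ∈ s, ⟪u, ω p⟫ ^ 2 - s.card * ⟪u, act W u⟫ := by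
        rw [Finset.sum_sub_distrib, ← nsmul_eq_mul, ← Finset.sum_const]
        congr 1
        exact Finset.sum_congr rfl fun p hp => by rw [hW p hp]
      rw [h6] at h4 h5
      rw [← abs_of_nonneg hθ0, ← abs_mul, abs_of_nonneg hθ0, abs_le]
      constructor <;> nlinarith
  have hcard : (N.card : ℝ) ≤ N.card ^ 2 := by
    exact_mod_cast Nat.le_self_pow two_ne_zero _
  have hbi : ∀ {α : Type _} (t : Finset α) (B : α → Set (I → State d)),
      (∀ a ∈ t, μ (B a) ≤ e) → μ (⋃ a ∈ t, B a) ≤ t.card * e := by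
    intro α t B h
    refine (measure_biUnion_finset_le t B).trans ((Finset.sum_le_sum h).trans ?_)
    rw [Finset.sum_const, nsmul_eq_mul]
  calc μ {ω | ¬ NetControl N s W ω (fun p => F p ω) R θ ℓ}
      ≤ (N ×ˢ N).card * e + (N.card * e + N.card * e) :=
        (measure_mono hsub).trans ((measure_union_le _ _).trans (add_le_add (hbi _ _ h1)
          ((measure_union_le _ _).trans (add_le_add (hbi _ _ h2) (hbi _ _ h3)))))
    _ = ENNReal.ofReal ((N.card ^ 2 + (N.card + N.card)) * Real.exp (-ℓ)) := by
        rw [he, ENNReal.ofReal_mul (by positivity), ENNReal.ofReal_add (by positivity)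
          (by positivity), ENNReal.ofReal_add (by positivity) (by positivity),
          ENNReal.ofReal_natCast, ← Nat.cast_pow, ENNReal.ofReal_natCast, Finset.card_product]
        push_cast
        ring
    _ ≤ _ := by
        refine ENNReal.ofReal_le_ofReal (mul_le_mul_of_nonneg_right ?_ (Real.exp_pos _).le)
        linarith

lemma abs_inner_le_of_norm_le {u : State d} {c : ℝ} (hu : ‖u‖ ≤ c) (y : State d) :
    |⟪u, y⟫| ≤ c * ‖y‖ :=
  (abs_real_inner_le_norm u y).trans (mul_le_mul_of_nonneg_right hu (norm_nonneg y))

lemma abs_sum_inner_sq_sub_le (s : Finset I) (x : I → State d) {u v : State d} {ε : ℝ}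
    (hu : ‖u‖ ≤ 1) (hv : ‖v‖ ≤ 1) (huv : ‖u - v‖ ≤ ε) :
    |∑ p ∈ s, ⟪u, x p⟫ ^ 2 - ∑ p ∈ s, ⟪v, x p⟫ ^ 2| ≤ 2 * ε * ∑ p ∈ s, ‖x p‖ ^ 2 := by
  rw [← Finset.sum_sub_distrib, Finset.mul_sum]
  refine (Finset.abs_sum_le_sum_abs _ _).trans (Finset.sum_le_sum fun p _ => ?_)
  have h1 : ⟪u, x p⟫ ^ 2 - ⟪v, x p⟫ ^ 2 = ⟪u - v, x p⟫ * (⟪u, x p⟫ + ⟪v, x p⟫) := by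
    rw [inner_sub_left]; ring
  rw [h1, abs_mul]
  have h2 := abs_inner_le_of_norm_le huv (x p)
  have h3 : |⟪u, x p⟫ + ⟪v, x p⟫| ≤ 2 * ‖x p‖ := by
    have := abs_inner_le_of_norm_le hu (x p)
    have := abs_inner_le_of_norm_le hv (x p)
    refine (abs_add_le _ _).trans ?_
    linarith
  calc _ ≤ (ε * ‖x p‖) * (2 * ‖x p‖) :=
        mul_le_mul h2 h3 (abs_nonneg _) ((abs_nonneg _).trans h2)
    _ = _ := by ring

lemma abs_sum_inner_mul_inner_sub_le (s : Finset I) (w x : I → State d) {u u' v v' : State d}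
    {ε : ℝ} (hv : ‖v‖ ≤ 1) (hu' : ‖u'‖ ≤ 1) (huu : ‖u - u'‖ ≤ ε)
    (hvv : ‖v - v'‖ ≤ ε) :
    |∑ p ∈ s, ⟪u, w p⟫ * ⟪v, x p⟫ - ∑ p ∈ s, ⟪u', w p⟫ * ⟪v', x p⟫| ≤
      ε * (∑ p ∈ s, ‖w p‖ ^ 2 + ∑ p ∈ s, ‖x p‖ ^ 2) := by
  rw [← Finset.sum_sub_distrib, ← Finset.sum_add_distrib, Finset.mul_sum]
  refine (Finset.abs_sum_le_sum_abs _ _).trans (Finset.sum_le_sum fun p _ => ?_)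
  have h1 : ⟪u, w p⟫ * ⟪v, x p⟫ - ⟪u', w p⟫ * ⟪v', x p⟫ =
      ⟪u - u', w p⟫ * ⟪v, x p⟫ + ⟪u', w p⟫ * ⟪v - v', x p⟫ := by
    rw [inner_sub_left, inner_sub_left]; ring
  have h2 := abs_inner_le_of_norm_le huu (w p)
  have h3 := abs_inner_le_of_norm_le hvv (x p)
  have h4 := abs_inner_le_of_norm_le hv (x p)
  have h5 := abs_inner_le_of_norm_le hu' (w p)
  have hε : 0 ≤ ε := (norm_nonneg _).trans huu
  rw [h1]
  refine (abs_add_le _ _).trans ?_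
  rw [abs_mul, abs_mul]
  have h6 := mul_le_mul h2 h4 (abs_nonneg _) ((abs_nonneg _).trans h2)
  have h7 := mul_le_mul h5 h3 (abs_nonneg _) ((abs_nonneg _).trans h5)
  nlinarith [mul_nonneg hε (sq_nonneg (‖w p‖ - ‖x p‖))]

lemma abs_inner_act_self_sub_le (W : Matrix (Fin d) (Fin d) ℝ) {u v : State d} {ε : ℝ}
    (hu : ‖u‖ ≤ 1) (hv : ‖v‖ ≤ 1) (huv : ‖u - v‖ ≤ ε) :
    |⟪u, act W u⟫ - ⟪v, act W v⟫| ≤ 2 * ε * specNorm W := by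
  have h1 : ⟪u, act W u⟫ - ⟪v, act W v⟫ = ⟪u - v, act W u⟫ + ⟪v, act W (u - v)⟫ := by
    rw [act_sub, inner_sub_left, inner_sub_right]; ring
  have h0 := specNorm_nonneg W
  have hε : 0 ≤ ε := (norm_nonneg _).trans huv
  have h2 : |⟪u - v, act W u⟫| ≤ ε * (specNorm W * 1) :=
    (abs_inner_le_of_norm_le huv _).trans (mul_le_mul_of_nonneg_left
      ((norm_act_le W u).trans (mul_le_mul_of_nonneg_left hu h0)) hε)
  have h3 : |⟪v, act W (u - v)⟫| ≤ 1 * (specNorm W * ε) :=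
    (abs_inner_le_of_norm_le hv _).trans (mul_le_mul_of_nonneg_left
      ((norm_act_le W _).trans (mul_le_mul_of_nonneg_left huv h0)) zero_le_one)
  rw [h1]
  refine (abs_add_le _ _).trans ?_
  linarith

/-- Optimizing the scale of `z` turns the exponential-moment bound into a self-normalized one. -/
lemma cross_le_sqrt_of_scaled {s : Finset I} {w x : I → State d} {R τ Λ ν : ℝ} (hR : 0 < R)
    (hτ : 0 < τ) (hΛ : 0 < Λ) (hν : 0 < ν) (hRν : 2 * Λ ≤ R ^ 2 * (τ * ν))
    {u : State d} (h : ∀ v : State d, ‖v‖ ≤ 1 → R * ∑ p ∈ s, ⟪u, w p⟫ * ⟪v, x p⟫ ≤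
      Λ + τ / 2 * (R ^ 2 * ∑ p ∈ s, ⟪v, x p⟫ ^ 2)) (z : State d) :
    ∑ p ∈ s, ⟪u, w p⟫ * ⟪z, x p⟫ ≤
      √(2 * Λ * τ * (∑ p ∈ s, ⟪z, x p⟫ ^ 2 + ν * ‖z‖ ^ 2)) := by
  rcases eq_or_ne z 0 with rfl | hz
  · simp
  set q := ∑ p ∈ s, ⟪z, x p⟫ ^ 2
  have hq : 0 ≤ q := Finset.sum_nonneg fun _ _ => sq_nonneg _
  have hzp : 0 < ‖z‖ := norm_pos_iff.2 hz
  set Q := q + ν * ‖z‖ ^ 2 with hQ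
  have hQp : 0 < Q := by positivity
  set r := √(2 * Λ * τ * Q) with hr
  have hrp : 0 < r := Real.sqrt_pos.2 (by positivity)
  have hr2 : r ^ 2 = 2 * Λ * τ * Q := Real.sq_sqrt (by positivity)
  -- This `c = √(2 Λ / (τ Q))` minimizes `Λ / c + τ c Q / 2`.
  set c := r / (τ * Q) with hc
  have hcp : 0 < c := by positivity
  have hc2 : c ^ 2 * (τ * Q) = 2 * Λ := by
    rw [hc, div_pow, hr2]; field_simp
  -- The regularizer `ν ‖z‖²` inside `Q` is what keeps the rescaled vector `c z` in the ball of
  -- radius `R` on which the hypothesis applies.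
  have hcz : c * ‖z‖ ≤ R := by
    refine le_of_sq_le_sq ?_ hR.le
    have h1 : c ^ 2 * (τ * (ν * ‖z‖ ^ 2)) ≤ 2 * Λ := by
      rw [← hc2]
      gcongr
      linarith
    have h2 : (c * ‖z‖) ^ 2 * (τ * ν) ≤ R ^ 2 * (τ * ν) := by
      calc _ = c ^ 2 * (τ * (ν * ‖z‖ ^ 2)) := by ring
        _ ≤ _ := h1.trans hRν
    exact le_of_mul_le_mul_right h2 (by positivity)
  have h3 := h ((c / R) • z) (by
    rw [norm_smul, Real.norm_of_nonneg (by positivity), div_mul_eq_mul_div, div_le_one hR]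
    exact hcz)
  have h4 : R * ∑ p ∈ s, ⟪u, w p⟫ * ⟪(c / R) • z, x p⟫ = c * ∑ p ∈ s, ⟪u, w p⟫ * ⟪z, x p⟫ := by
    rw [Finset.mul_sum, Finset.mul_sum]
    refine Finset.sum_congr rfl fun p _ => ?_
    rw [real_inner_smul_left]; field_simp
  have h5 : R ^ 2 * ∑ p ∈ s, ⟪(c / R) • z, x p⟫ ^ 2 = c ^ 2 * q := by
    rw [Finset.mul_sum, Finset.mul_sum]
    refine Finset.sum_congr rfl fun p _ => ?_
    rw [real_inner_smul_left]; field_simp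
  rw [h4, h5] at h3
  have h6 : c ^ 2 * (τ * q) ≤ 2 * Λ := by
    rw [← hc2]
    gcongr
    nlinarith [mul_pos hν (pow_pos hzp 2)]
  have h7 : c * ∑ p ∈ s, ⟪u, w p⟫ * ⟪z, x p⟫ ≤ c * r := by
    have : c * r = 2 * Λ := by
      rw [hc, div_mul_eq_mul_div, ← pow_two, hr2]; field_simp
    rw [this]; linarith
  exact le_of_mul_le_mul_left h7 hcp

/-- Here `r = √(ℓ n)`, and the step `θ = r / (4 τ n)` is half the minimizer of `ℓ / θ + 4 θ τ² n`.
It costs `5 τ r` in place of `4 τ r`, but satisfies `θ τ ≤ 1 / 4` as soon as `ℓ ≤ n`. -/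
lemma chernoff_scale_identity {n τ : ℝ} (hn : n ≠ 0) (hτ : τ ≠ 0) (r : ℝ) :
    r ^ 2 / n + 4 * (r / (4 * τ * n)) ^ 2 * τ ^ 2 * n = r / (4 * τ * n) * (5 * τ * r) := by
  field_simp
  norm_num

/-- Each direction is replaced by a net point. In the cross bound, `herr₁` and `herr₂` each allow an
error of one, whence `ℓ + 2 ≤ Λ`. In the square bound, `herr₃` allows an error `τ ≤ τ √(Λ n)`, with
`n` the cardinality of `s`, which turns the Chernoff constant 5 into 6. -/
lemma NetControl.noiseControl {N : Finset (State d)} {s : Finset I}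
    {W : Matrix (Fin d) (Fin d) ℝ} {w x : I → State d} {R θ ℓ ε Λ ν w₂ x₂ : ℝ}
    (h : NetControl N s W w x R θ ℓ) (hN : ∀ u ∈ N, ‖u‖ ≤ 1)
    (hcover : ∀ u : State d, ‖u‖ ≤ 1 → ∃ v ∈ N, ‖u - v‖ ≤ ε)
    (hw : ∑ p ∈ s, ‖w p‖ ^ 2 ≤ w₂) (hx : ∑ p ∈ s, ‖x p‖ ^ 2 ≤ x₂) (hR : 0 < R) (hε : 0 ≤ ε)
    (hτ : 0 < specNorm W) (hν : 0 < ν) (hℓ : 1 ≤ ℓ) (hs : ℓ ≤ s.card)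
    (hΛ : ℓ + 2 ≤ Λ) (hRν : 2 * Λ ≤ R ^ 2 * (specNorm W * ν))
    (hθ : θ = √(ℓ / s.card) / (4 * specNorm W))
    (herr₁ : R * (ε * (w₂ + x₂)) ≤ 1) (herr₂ : specNorm W * R ^ 2 * (ε * x₂) ≤ 1)
    (herr₃ : 2 * ε * w₂ + s.card * (2 * ε * specNorm W) ≤ specNorm W) :
    NoiseControl s W w x Λ ν := by
  set τ := specNorm W
  refine ⟨fun u z hu => cross_le_sqrt_of_scaled hR hτ (by linarith) hν hRν (fun v hv => ?_) z,
    fun u hu => ?_⟩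
  · obtain ⟨u', hu', huu⟩ := hcover u hu
    obtain ⟨v', hv', hvv⟩ := hcover v hv
    have h1 := h.cross u' hu' v' hv'
    simp_rw [real_inner_smul_left, mul_pow] at h1
    rw [← Finset.mul_sum] at h1
    have h2 : ∑ p ∈ s, ⟪u', w p⟫ * (R * ⟪v', x p⟫) = R * ∑ p ∈ s, ⟪u', w p⟫ * ⟪v', x p⟫ := by
      rw [Finset.mul_sum]; exact Finset.sum_congr rfl fun p _ => by ring
    rw [h2] at h1
    have h3 := (abs_le.1 (abs_sum_inner_mul_inner_sub_le s w x hv (hN _ hu') huu hvv)).2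
    have h4 := (abs_le.1 (abs_sum_inner_sq_sub_le s x hv (hN _ hv') hvv)).1
    have h5 : R * (∑ p ∈ s, ⟪u, w p⟫ * ⟪v, x p⟫) ≤
        R * ∑ p ∈ s, ⟪u', w p⟫ * ⟪v', x p⟫ + R * (ε * (w₂ + x₂)) := by
      rw [← mul_add]
      refine mul_le_mul_of_nonneg_left ?_ hR.le
      have : ε * (∑ p ∈ s, ‖w p‖ ^ 2 + ∑ p ∈ s, ‖x p‖ ^ 2) ≤ ε * (w₂ + x₂) := by gcongr
      linarith
    have h6 : τ / 2 * (R ^ 2 * ∑ p ∈ s, ⟪v', x p⟫ ^ 2) ≤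
        τ / 2 * (R ^ 2 * ∑ p ∈ s, ⟪v, x p⟫ ^ 2) + τ * R ^ 2 * (ε * x₂) := by
      have : τ / 2 * (R ^ 2 * ∑ p ∈ s, ⟪v', x p⟫ ^ 2) ≤
          τ / 2 * (R ^ 2 * (∑ p ∈ s, ⟪v, x p⟫ ^ 2 + 2 * ε * x₂)) := by
        have : 2 * ε * ∑ p ∈ s, ‖x p‖ ^ 2 ≤ 2 * ε * x₂ := by gcongr
        gcongr
        linarith
      refine this.trans (le_of_eq ?_)
      ring
    linarith
  · obtain ⟨u', hu', huu⟩ := hcover u hu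
    have hn : (0 : ℝ) < s.card := by linarith
    have h1 := h.square u' hu'
    have h2 := abs_sum_inner_sq_sub_le s w hu (hN _ hu') huu
    have h3 := abs_inner_act_self_sub_le W hu (hN _ hu') huu
    have h4 : |(s.card : ℝ) * ⟪u, act W u⟫ - s.card * ⟪u', act W u'⟫| ≤
        s.card * (2 * ε * τ) := by
      rw [← mul_sub, abs_mul, abs_of_pos hn]; gcongr
    have h5 : |∑ p ∈ s, ⟪u', w p⟫ ^ 2 - s.card * ⟪u', act W u'⟫| ≤ 5 * τ * √(ℓ * s.card) := by
      set r := √(ℓ * s.card) with hr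
      have hrp : 0 < r := Real.sqrt_pos.2 (by positivity)
      have hr2 : r ^ 2 = ℓ * s.card := Real.sq_sqrt (by positivity)
      have hθ' : θ = r / (4 * τ * s.card) := by
        have : √(ℓ / s.card) = r / s.card := by
          rw [hr, Real.sqrt_mul (by linarith), Real.sqrt_div (by linarith), div_eq_div_iff
            (Real.sqrt_pos.2 hn).ne' hn.ne', mul_assoc, Real.mul_self_sqrt hn.le]
        rw [hθ, this]; field_simp
      have hθp : 0 < θ := by rw [hθ']; positivity
      refine le_of_mul_le_mul_left (h1.trans (le_of_eq ?_)) hθp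
      have h6 : ℓ = r ^ 2 / s.card := by rw [hr2]; field_simp
      calc ℓ + 4 * θ ^ 2 * τ ^ 2 * s.card =
            r ^ 2 / s.card + 4 * (r / (4 * τ * s.card)) ^ 2 * τ ^ 2 * s.card := by rw [← h6, ← hθ']
        _ = r / (4 * τ * s.card) * (5 * τ * r) := chernoff_scale_identity hn.ne' hτ.ne' r
        _ = θ * (5 * τ * r) := by rw [← hθ']
    have h7 : 1 ≤ √(Λ * s.card) := Real.one_le_sqrt.2 (by nlinarith)
    have h8 : √(ℓ * s.card) ≤ √(Λ * s.card) := Real.sqrt_le_sqrt (by gcongr; linarith)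
    have h9 : 2 * ε * ∑ p ∈ s, ‖w p‖ ^ 2 ≤ 2 * ε * w₂ := by gcongr
    have h10 : |∑ p ∈ s, ⟪u, w p⟫ ^ 2 - s.card * ⟪u, act W u⟫| ≤
        5 * τ * √(ℓ * s.card) + (2 * ε * w₂ + s.card * (2 * ε * τ)) := by
      rw [abs_le] at *
      constructor <;> linarith [h2.1, h2.2, h4.1, h4.2, h5.1, h5.2]
    have h11 : 5 * τ * √(ℓ * s.card) ≤ 5 * τ * √(Λ * s.card) := by gcongr
    nlinarith

end NoiseControl

/-! ### Index sets of a cluster -/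

section Cluster

variable {d M : ℕ}

/-- All pairs of a trajectory in `C` and a time at which its noise acts. -/
def clusterIndex (T : Fin M → ℕ) (C : Finset (Fin M)) : Finset ((m : Fin M) × Fin (T m)) :=
  C.sigma fun _ => Finset.univ

/-- The pairs in `clusterIndex T C` except for the last time of each trajectory. -/
def innerIndex (T : Fin M → ℕ) (C : Finset (Fin M)) : Finset ((m : Fin M) × Fin (T m)) :=
  C.sigma fun m => Finset.univ.filter fun t => (t : ℕ) + 1 < T m

lemma sum_clusterIndex {β : Type*} [AddCommMonoid β] (T : Fin M → ℕ) (C : Finset (Fin M))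
    (f : Fin M → ℕ → β) :
    ∑ p ∈ clusterIndex T C, f p.1 p.2 = ∑ m ∈ C, ∑ t ∈ Finset.range (T m), f m t := by
  rw [clusterIndex, Finset.sum_sigma]
  exact Finset.sum_congr rfl fun m _ => (Finset.sum_range fun t => f m t).symm

lemma sum_innerIndex {β : Type*} [AddCommMonoid β] (T : Fin M → ℕ) (C : Finset (Fin M))
    (f : Fin M → ℕ → β) :
    ∑ p ∈ innerIndex T C, f p.1 p.2 = ∑ m ∈ C, ∑ t ∈ Finset.range (T m - 1), f m t := by
  rw [innerIndex, Finset.sum_sigma]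
  refine Finset.sum_congr rfl fun m _ => ?_
  rw [Finset.sum_filter]
  refine (Finset.sum_range (n := T m) fun t => if t + 1 < T m then f m t else 0).symm.trans ?_
  rw [← Finset.sum_filter]
  refine Finset.sum_congr ?_ fun _ _ => rfl
  ext t
  simp only [Finset.mem_filter, Finset.mem_range]
  omega

lemma card_clusterIndex (T : Fin M → ℕ) (C : Finset (Fin M)) :
    (clusterIndex T C).card = clusterLength T C := by
  simp [clusterIndex, clusterLength]

lemma card_innerIndex (T : Fin M → ℕ) (C : Finset (Fin M)) :
    (innerIndex T C).card = ∑ m ∈ C, (T m - 1) := by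
  rw [Finset.card_eq_sum_ones, sum_innerIndex T C fun _ _ => 1]
  simp

lemma innerIndex_subset (T : Fin M → ℕ) (C : Finset (Fin M)) :
    innerIndex T C ⊆ clusterIndex T C :=
  Finset.sigma_mono subset_rfl fun _ => Finset.filter_subset _ _

lemma card_innerIndex_ge {T : Fin M → ℕ} {C : Finset (Fin M)} (hT : ∀ m ∈ C, 4 ≤ T m) :
    3 / 4 * (clusterLength T C : ℝ) ≤ (innerIndex T C).card := by
  have h : 3 * clusterLength T C ≤ 4 * (innerIndex T C).card := by
    rw [card_innerIndex, clusterLength, Finset.mul_sum, Finset.mul_sum]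
    refine Finset.sum_le_sum fun m hm => ?_
    have := hT m hm
    omega
  have h' : (3 : ℝ) * clusterLength T C ≤ 4 * (innerIndex T C).card := by exact_mod_cast h
  linarith

lemma card_innerIndex_le (T : Fin M → ℕ) (C : Finset (Fin M)) :
    ((innerIndex T C).card : ℝ) ≤ clusterLength T C := by
  rw [← card_clusterIndex]
  exact_mod_cast Finset.card_le_card (innerIndex_subset T C)

/-- The shifted times `1, …, T m - 1` are among the times summed in the Gram matrix; only the
time-zero terms are dropped. -/
lemma sum_succ_le_sum_clusterIndex {T : Fin M → ℕ} {C : Finset (Fin M)}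
    (hT : ∀ m ∈ C, 4 ≤ T m) (f : Fin M → ℕ → ℝ) (hf : ∀ m t, 0 ≤ f m t) :
    ∑ p ∈ innerIndex T C, f p.1 (p.2 + 1) ≤ ∑ p ∈ clusterIndex T C, f p.1 p.2 := by
  rw [sum_clusterIndex, sum_innerIndex T C fun m t => f m (t + 1)]
  refine Finset.sum_le_sum fun m hm => ?_
  obtain ⟨n, hn⟩ : ∃ n, T m = n + 1 := ⟨T m - 1, by have := hT m hm; omega⟩
  rw [hn, Finset.sum_range_succ' _ n, Nat.add_sub_cancel]
  linarith [hf m 0]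

end Cluster

/-! ### Estimation bounds on the good event -/

section Deterministic

variable {d M : ℕ} {T : Fin M → ℕ} {y w : Fin M → ℕ → State d} {A W : Matrix (Fin d) (Fin d) ℝ}
  {C : Finset (Fin M)} {κ κw s Λ D : ℝ}

lemma two_mul_sqrt_mul_le {a b : ℝ} (ha : 0 ≤ a) (hb : 0 ≤ b) : 2 * √(a * b) ≤ a + b := by
  have : √(a * b) ≤ (a + b) / 2 :=
    Real.sqrt_le_iff.2 ⟨by linarith, by nlinarith [sq_nonneg (a - b)]⟩
  linarith

/-- The excitation by the noise bounds the Gram matrix from below. -/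
lemma gram_lower_bound
    (hdyn : ∀ m ∈ C, ∀ t < T m, y m (t + 1) = act A (y m t) + w m t)
    (hT : ∀ m ∈ C, 4 ≤ T m) (hn4 : (4 : ℝ) ≤ clusterLength T C) (hκ : 0 < κ) (hA : specNorm A ≤ κ)
    (hs : 0 < s) (hW : ∀ u : State d, s * ‖u‖ ^ 2 ≤ ⟪u, act W u⟫) (hκw : 1 ≤ κw)
    (hτ : specNorm W ≤ κw * s) (hΛ0 : 0 ≤ Λ) (hΛ : Λ ≤ 62 * D)
    (hn : 620000 * D * κw ^ 2 ≤ clusterLength T C)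
    (h : NoiseControl (innerIndex T C) W (fun p => w p.1 p.2) (fun p => y p.1 p.2) Λ (s / κ ^ 2))
    (u : State d) :
    clusterLength T C * s / 4 * ‖u‖ ^ 2 ≤ ∑ p ∈ clusterIndex T C, ⟪u, y p.1 p.2⟫ ^ 2 := by
  set n : ℝ := (clusterLength T C : ℝ) with hn_def
  set τ := specNorm W with hτdef
  have hτ0 : 0 ≤ τ := specNorm_nonneg W
  have hunit : ∀ u : State d, ‖u‖ = 1 →
      n * s / 4 ≤ ∑ p ∈ clusterIndex T C, ⟪u, y p.1 p.2⟫ ^ 2 := by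
    intro u hu
    refine le_trans ?_ (sum_succ_le_sum_clusterIndex hT (fun m t => ⟪u, y m t⟫ ^ 2)
      fun _ _ => sq_nonneg _)
    set z := act A.transpose u with hz
    set a := ∑ p ∈ innerIndex T C, ⟪z, y p.1 p.2⟫ ^ 2 with ha
    set b := ∑ p ∈ innerIndex T C, ⟪u, w p.1 p.2⟫ * ⟪z, y p.1 p.2⟫ with hb
    set c := ∑ p ∈ innerIndex T C, ⟪u, w p.1 p.2⟫ ^ 2 with hc
    set n' : ℝ := ((innerIndex T C).card : ℝ) with hn'
    have hexp : ∑ p ∈ innerIndex T C, ⟪u, y p.1 (p.2 + 1)⟫ ^ 2 = a + 2 * b + c := by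
      rw [ha, hb, hc, Finset.mul_sum, ← Finset.sum_add_distrib, ← Finset.sum_add_distrib]
      refine Finset.sum_congr rfl fun p hp => ?_
      have hpC : p.1 ∈ C := (Finset.mem_sigma.1 hp).1
      rw [hdyn p.1 hpC p.2 p.2.2, inner_add_right, inner_act_transpose]
      ring
    have ha0 : 0 ≤ a := Finset.sum_nonneg fun _ _ => sq_nonneg _
    have hzκ : ‖z‖ ≤ κ := by
      have := norm_act_le A.transpose u
      rw [specNorm_transpose, hu, mul_one] at this
      exact this.trans hA
    -- The regularizer `ν = s / κ²` is chosen so that it adds at most `s` for `z = Aᵀ u`.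
    have hzs : s / κ ^ 2 * ‖z‖ ^ 2 ≤ s := by
      rw [div_mul_eq_mul_div, div_le_iff₀ (by positivity)]
      gcongr
    have hb1 : -b ≤ √(2 * Λ * τ * (a + s)) := by
      have h1 := h.cross (-u) z (by rw [norm_neg, hu])
      simp only [inner_neg_left, neg_mul, Finset.sum_neg_distrib] at h1
      refine h1.trans (Real.sqrt_le_sqrt ?_)
      gcongr
    -- By the arithmetic-geometric mean inequality `2 b ≥ -(2 Λ τ + a + s)`, so the unknown energy
    -- `a` cancels in `a + 2 b + c`.
    have hb2 := two_mul_sqrt_mul_le (a := 2 * Λ * τ) (b := a + s) (by positivity) (by positivity)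
    have hc1 := (abs_le.1 (h.square u hu.le)).1
    have hWu := hW u
    rw [hu, one_pow, mul_one] at hWu
    have hn'1 : 3 / 4 * n ≤ n' := card_innerIndex_ge hT
    have hn'2 : n' ≤ n := card_innerIndex_le T C
    have hn'0 : 0 ≤ n' := Nat.cast_nonneg _
    -- The constant 620000 is `62 * 100²`: it makes the fluctuation of the noise energy at most `6 /
    -- 100` of `n s`.
    have hsqrt : √(Λ * n') ≤ n / (100 * κw) := by
      refine Real.sqrt_le_iff.2 ⟨by positivity, ?_⟩
      rw [div_pow, le_div_iff₀ (by positivity)]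
      have h1 : Λ * n' ≤ 62 * D * n := mul_le_mul hΛ hn'2 hn'0 (hΛ0.trans hΛ)
      calc Λ * n' * (100 * κw) ^ 2 ≤ 62 * D * n * (100 * κw) ^ 2 := by gcongr
        _ = 620000 * D * κw ^ 2 * n := by ring
        _ ≤ n * n := by gcongr
        _ = n ^ 2 := by ring
    have h3 : τ * √(Λ * n') ≤ s * n / 100 := by
      calc τ * √(Λ * n') ≤ (κw * s) * (n / (100 * κw)) := by gcongr
        _ = s * n / 100 := by field_simp
    have h4 : Λ * τ ≤ s * n / 10000 := by
      have hD : 0 ≤ D := by linarith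
      calc Λ * τ ≤ (62 * D) * (κw * s) := by gcongr
        _ ≤ (62 * D) * (κw ^ 2 * s) := by gcongr; nlinarith
        _ = 620000 * D * κw ^ 2 * s / 10000 := by ring
        _ ≤ n * s / 10000 := by gcongr
        _ = s * n / 10000 := by ring
    have h5 : n' * s ≤ n' * ⟪u, act W u⟫ := by gcongr
    have h6 : 3 / 4 * n * s ≤ n' * s := by gcongr
    have h7 : 4 * s ≤ n * s := by gcongr
    rw [hexp]
    linarith
  rcases eq_or_ne u 0 with rfl | hu
  · simp
  have hup : 0 < ‖u‖ := norm_pos_iff.2 hu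
  have h1 := hunit (‖u‖⁻¹ • u) (by
    rw [norm_smul, norm_inv, norm_norm, inv_mul_cancel₀ hup.ne'])
  simp_rw [real_inner_smul_left, mul_pow] at h1
  rw [← Finset.mul_sum, inv_pow, ← div_eq_inv_mul, le_div_iff₀ (by positivity)] at h1
  exact h1

lemma sqrt_le_natCast_mul_sqrt {a b : ℝ} (k : ℕ) (h : a ≤ (k : ℝ) ^ 2 * b) : √a ≤ k * √b := by
  refine (Real.sqrt_le_sqrt h).trans (le_of_eq ?_)
  rw [Real.sqrt_mul (by positivity), Real.sqrt_sq (by positivity)]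

/-- Uniform noise control implies the estimation bounds for one model. -/
lemma estimation_bounds
    (hdyn : ∀ m ∈ C, ∀ t < T m, y m (t + 1) = act A (y m t) + w m t)
    (hT : ∀ m ∈ C, 4 ≤ T m) (hn4 : (4 : ℝ) ≤ clusterLength T C) (hκ : 1 ≤ κ) (hA : specNorm A ≤ κ)
    (hs : 0 < s) (hW : ∀ u : State d, s * ‖u‖ ^ 2 ≤ ⟪u, act W u⟫) (hWt : W.transpose = W)
    (hτ0 : 0 < specNorm W) (hκw : 1 ≤ κw)
    (hτ : specNorm W ≤ κw * s) (hΛ0 : 0 ≤ Λ) (hΛ : Λ ≤ 62 * D)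
    (hn : 620000 * D * κw ^ 2 ≤ clusterLength T C)
    (h : NoiseControl (clusterIndex T C) W (fun p => w p.1 p.2) (fun p => y p.1 p.2) Λ (s / κ ^ 2))
    (h' : NoiseControl (innerIndex T C) W (fun p => w p.1 p.2) (fun p => y p.1 p.2) Λ
      (s / κ ^ 2)) :
    IsUnit (gram T y C) ∧
      specNorm (estA T y C - A) ≤ 32 * √(D * κw / clusterLength T C) ∧
      specNorm (estW T y C - W) / specNorm W ≤ 80 * √(D / clusterLength T C) := by
  have hG := gram_lower_bound hdyn hT hn4 (by linarith) hA hs hW hκw hτ hΛ0 hΛ hn h'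
  have hD : 0 ≤ D := by linarith
  have hcard : ((clusterIndex T C).card : ℝ) = clusterLength T C := by rw [card_clusterIndex]
  set n : ℝ := (clusterLength T C : ℝ) with hn_def
  have hn0 : 0 < n := by linarith
  have hg : 0 < n * s / 4 := by positivity
  set τ := specNorm W with hτdef
  set S := clusterIndex T C
  have hx : ∀ p ∈ S, y p.1 (p.2 + 1) = act A (y p.1 p.2) + w p.1 p.2 := fun p hp =>
    hdyn p.1 (Finset.mem_sigma.1 hp).1 p.2 p.2.2
  -- The Gram lower bound absorbs the regularizer at the price of doubling `2 Λ τ`.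
  have hcross : ∀ u z : State d, ‖u‖ ≤ 1 → ∑ p ∈ S, ⟪u, w p.1 p.2⟫ * ⟪z, y p.1 p.2⟫ ≤
      √(4 * Λ * τ * ∑ p ∈ S, ⟪z, y p.1 p.2⟫ ^ 2) := by
    intro u z hu
    refine (h.cross u z hu).trans (Real.sqrt_le_sqrt ?_)
    have h1 : s / κ ^ 2 * ‖z‖ ^ 2 ≤ ∑ p ∈ S, ⟪z, y p.1 p.2⟫ ^ 2 := by
      refine le_trans ?_ (hG z)
      refine mul_le_mul_of_nonneg_right ?_ (sq_nonneg _)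
      have h2 : s / κ ^ 2 ≤ s := div_le_self hs.le (one_le_pow₀ hκ)
      nlinarith
    calc 2 * Λ * τ * (∑ p ∈ S, ⟪z, y p.1 p.2⟫ ^ 2 + s / κ ^ 2 * ‖z‖ ^ 2)
        ≤ 2 * Λ * τ * (∑ p ∈ S, ⟪z, y p.1 p.2⟫ ^ 2 + ∑ p ∈ S, ⟪z, y p.1 p.2⟫ ^ 2) := by gcongr
      _ = _ := by ring
  have hgram : gram T y C = ∑ p ∈ S, outer (y p.1 p.2) (y p.1 p.2) :=
    (sum_clusterIndex T C fun m t => outer (y m t) (y m t)).symm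
  have hest : estA T y C = (∑ p ∈ S, outer (y p.1 (p.2 + 1)) (y p.1 p.2)) *
      (∑ p ∈ S, outer (y p.1 p.2) (y p.1 p.2))⁻¹ := by
    rw [estA, hgram, ← sum_clusterIndex T C fun m t => outer (y m (t + 1)) (y m t)]
  have hβ : 0 ≤ 4 * Λ * τ := by positivity
  refine ⟨?_, ?_, ?_⟩
  · rw [hgram]
    exact isUnit_sum_outer hg hG
  · have h1 := least_squares_specNorm_le (x := fun p : (m : Fin M) × Fin (T m) => y p.1 p.2)
      (x' := fun p => y p.1 (p.2 + 1)) (w := fun p => w p.1 p.2) (A := A) hx hg hβ hG hcross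
    rw [hest]
    refine h1.trans ?_
    -- The ratio is `16 Λ τ / (n s) ≤ 992 D κw / n`, and `992 ≤ 32²`.
    have h2 := sqrt_le_natCast_mul_sqrt (a := 4 * Λ * τ / (n * s / 4)) (b := D * κw / n) 32 ?_
    · simpa using h2
    · rw [div_le_iff₀ hg]
      have h3 : Λ * τ ≤ (62 * D) * (κw * s) := by gcongr
      have h4 : ((32 : ℕ) : ℝ) ^ 2 * (D * κw / n) * (n * s / 4) = 256 * (D * (κw * s)) := by
        push_cast
        field_simp
        ring
      rw [h4]
      have h5 : 0 ≤ D * (κw * s) := by positivity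
      linarith
  · have hres := residual_sq_sum_sub_le (x := fun p : (m : Fin M) × Fin (T m) => y p.1 p.2)
      (x' := fun p => y p.1 (p.2 + 1)) (w := fun p => w p.1 p.2) (A := A) hx hg hβ hG hcross hest
    have hestW : estW T y C = (1 / n) • ∑ p ∈ S, outer (residual T y C p.1 p.2)
        (residual T y C p.1 p.2) := by
      rw [estW, ← sum_clusterIndex T C fun m t => outer (residual T y C m t) (residual T y C m t)]
    -- This gives `Λ / n ≤ √(Λ / n)`, so the residual term with factor 4 joins the noise fluctuation
    -- with factor 6 to give 10.
    have hΛn : Λ / n ≤ 1 := by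
      rw [div_le_one hn0]
      have : (1 : ℝ) ≤ κw ^ 2 := one_le_pow₀ hκw
      nlinarith
    have hsq : √(Λ / n) ^ 2 = Λ / n := Real.sq_sqrt (by positivity)
    have hsq1 : Λ / n ≤ √(Λ / n) := by
      exact hsq.ge.trans
        (pow_le_of_le_one (Real.sqrt_nonneg _) (Real.sqrt_le_one.2 hΛn) two_ne_zero)
    have hsq2 : √(Λ * n) / n = √(Λ / n) := by
      rw [Real.sqrt_mul hΛ0, Real.sqrt_div hΛ0, div_eq_div_iff hn0.ne' (Real.sqrt_pos.2 hn0).ne',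
        mul_assoc, Real.mul_self_sqrt hn0.le]
    have hunit : ∀ u : State d, ‖u‖ ≤ 1 → |⟪u, act (estW T y C - W) u⟫| ≤ 10 * τ * √(Λ / n) := by
      intro u hu
      have h1 := hres u hu
      have h2 := h.square u hu
      rw [hcard] at h2
      have h3 : ⟪u, act (estW T y C - W) u⟫ =
          (∑ p ∈ S, ⟪u, y p.1 (p.2 + 1) - act (estA T y C) (y p.1 p.2)⟫ ^ 2 -
            n * ⟪u, act W u⟫) / n := by
        rw [matrix_sub_act, inner_sub_right, hestW, matrix_smul_act, real_inner_smul_right,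
          inner_act_sum_outer]
        simp_rw [← pow_two, residual]
        field_simp
      rw [h3, abs_div, abs_of_pos hn0, div_le_iff₀ hn0]
      have h4 : |∑ p ∈ S, ⟪u, y p.1 (p.2 + 1) - act (estA T y C) (y p.1 p.2)⟫ ^ 2 -
            n * ⟪u, act W u⟫| ≤ 4 * Λ * τ + 6 * τ * √(Λ * n) := by
        refine le_trans (abs_sub_le _ (∑ p ∈ S, ⟪u, w p.1 p.2⟫ ^ 2) _) (add_le_add h1 h2)
      refine h4.trans ?_
      have h5 : √(Λ * n) = √(Λ / n) * n := by rw [← hsq2]; field_simp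
      have h6 : Λ ≤ √(Λ / n) * n := (div_le_iff₀ hn0).1 hsq1
      rw [h5]
      nlinarith
    have hsym : (estW T y C - W).transpose = estW T y C - W := by
      rw [Matrix.transpose_sub, hWt, hestW, Matrix.transpose_smul, sum_outer_self_transpose]
    have hspec : specNorm (estW T y C - W) ≤ 10 * τ * √(Λ / n) := by
      refine specNorm_le_of_abs_inner_self_le hsym (by positivity) fun u => ?_
      rcases eq_or_ne u 0 with rfl | hu
      · simp
      have hup : 0 < ‖u‖ := norm_pos_iff.2 hu
      have h1 := hunit (‖u‖⁻¹ • u) (by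
        rw [norm_smul, norm_inv, norm_norm, inv_mul_cancel₀ hup.ne'])
      rw [act_smul, real_inner_smul_left, real_inner_smul_right, ← mul_assoc, abs_mul,
        abs_of_pos (by positivity), ← mul_inv, ← pow_two, ← div_eq_inv_mul,
        div_le_iff₀ (by positivity)] at h1
      exact h1
    rw [div_le_iff₀ hτ0]
    -- Since `62 ≤ 8²`, the final constant is `10 * 8 = 80`.
    have h2 := sqrt_le_natCast_mul_sqrt (a := Λ / n) (b := D / n) 8 (by
      rw [mul_div_assoc']
      gcongr
      push_cast
      linarith)
    push_cast at h2
    calc _ ≤ 10 * τ * √(Λ / n) := hspec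
      _ ≤ 10 * τ * (8 * √(D / n)) := by gcongr
      _ = _ := by ring

end Deterministic

/-! ### Choice of radius, mesh and exponents -/

section Polynomial

variable {d : ℕ} {I : Type*}

/-- The radius `L ^ 4 / s` makes `R² τ ν` at least `L ^ 6`, enough to dominate `2 Λ`. The three
discretization errors, relative to their allowances, are then at most of order `ε L ^ 22`, so mesh
`L⁻²³` suffices. -/
lemma NetControl.noiseControl_of_poly {N : Finset (State d)} {t : Finset I}
    {W : Matrix (Fin d) (Fin d) ℝ} {w x : I → State d} {L s κ ℓ ε Λ : ℝ}
    (h : NetControl N t W w x (L ^ 4 / s) (√(ℓ / t.card) / (4 * specNorm W)) ℓ)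
    (hN : ∀ u ∈ N, ‖u‖ ≤ 1) (hcover : ∀ u : State d, ‖u‖ ≤ 1 → ∃ v ∈ N, ‖u - v‖ ≤ ε)
    (hL : 4 ≤ L) (hs : 0 < s) (hsτ : s ≤ specNorm W) (hτ : specNorm W ≤ L * s) (hκ : 1 ≤ κ)
    (hκL : κ ≤ L) (hℓ : 1 ≤ ℓ) (hℓt : ℓ ≤ t.card) (htL : (t.card : ℝ) ≤ L) (hΛ : ℓ + 2 ≤ Λ)
    (hΛL : 2 * Λ ≤ L ^ 6) (hε : 0 ≤ ε) (hεL : ε * L ^ 23 ≤ 1)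
    (hw : ∑ p ∈ t, ‖w p‖ ^ 2 ≤ L ^ 6 * s) (hx : ∑ p ∈ t, ‖x p‖ ^ 2 ≤ L ^ 13 * s) :
    NoiseControl t W w x Λ (s / κ ^ 2) := by
  have hL0 : 0 < L := by linarith
  have hL1 : 1 ≤ L := by linarith
  have hτ0 : 0 < specNorm W := hs.trans_le hsτ
  refine h.noiseControl hN hcover hw hx (by positivity) hε hτ0 (by positivity) hℓ hℓt hΛ ?_ rfl
    ?_ ?_ ?_
  · refine hΛL.trans ?_
    calc L ^ 6 = (L ^ 4 / s) ^ 2 * (s * (s / L ^ 2)) := by field_simp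
      _ ≤ (L ^ 4 / s) ^ 2 * (specNorm W * (s / κ ^ 2)) := by gcongr
  · calc L ^ 4 / s * (ε * (L ^ 6 * s + L ^ 13 * s)) = ε * (L ^ 10 + L ^ 17) := by
          field_simp
      _ ≤ ε * (L ^ 22 + L ^ 22) := by
          gcongr <;> first | exact hL1 | norm_num
      _ ≤ ε * (L * L ^ 22) := by gcongr; nlinarith [pow_pos hL0 22]
      _ = ε * L ^ 23 := by ring
      _ ≤ 1 := hεL
  · calc specNorm W * (L ^ 4 / s) ^ 2 * (ε * (L ^ 13 * s))
        ≤ (L * s) * (L ^ 4 / s) ^ 2 * (ε * (L ^ 13 * s)) := by gcongr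
      _ = ε * L ^ 22 := by field_simp
      _ ≤ ε * L ^ 23 := by gcongr; exacts [by norm_num]
      _ ≤ 1 := hεL
  · calc 2 * ε * (L ^ 6 * s) + t.card * (2 * ε * specNorm W)
        ≤ 2 * ε * (L ^ 6 * specNorm W) + L * (2 * ε * specNorm W) := by gcongr
      _ = specNorm W * (ε * (2 * L ^ 6 + 2 * L)) := by ring
      _ ≤ specNorm W * (ε * (2 * L ^ 22 + 2 * L ^ 22)) := by
          gcongr
          · norm_num
          · exact le_self_pow₀ hL1 (by norm_num)
      _ ≤ specNorm W * (ε * (L * L ^ 22)) := by gcongr; nlinarith [pow_pos hL0 22]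
      _ = specNorm W * (ε * L ^ 23) := by ring
      _ ≤ specNorm W := mul_le_of_le_one_right hτ0.le hεL

/-- A net of the unit ball with mesh `L⁻²³` and cardinality polynomial in `L`. -/
lemma exists_fine_net {L : ℝ} (hL : 4 ≤ L) (hd : (d : ℝ) ≤ L) :
    ∃ (N : Finset (State d)) (ε : ℝ), (∀ u ∈ N, ‖u‖ ≤ 1) ∧
      (∀ u : State d, ‖u‖ ≤ 1 → ∃ v ∈ N, ‖u - v‖ ≤ ε) ∧ (N.card : ℝ) ≤ L ^ (25 * d) ∧
      0 ≤ ε ∧ ε * L ^ 23 ≤ 1 := by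
  have hL0 : 0 < L := by linarith
  have hk : 0 < ⌈L ^ 24⌉₊ := Nat.ceil_pos.2 (by positivity)
  obtain ⟨N, h1, h2, h3⟩ := exists_unit_ball_net d ⌈L ^ 24⌉₊ hk
  have hk' : L ^ 24 ≤ (⌈L ^ 24⌉₊ : ℝ) := Nat.le_ceil _
  refine ⟨N, d / ⌈L ^ 24⌉₊, h1, h3, ?_, by positivity, ?_⟩
  · have h4 : (N.card : ℝ) ≤ (2 * (⌈L ^ 24⌉₊ : ℝ) + 1) ^ d := by exact_mod_cast h2
    rw [pow_mul]
    refine h4.trans (pow_le_pow_left₀ (by positivity) ?_ d)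
    have h5 := Nat.ceil_lt_add_one (show 0 ≤ L ^ 24 by positivity)
    have h6 : (4 : ℝ) ≤ L ^ 24 := hL.trans (le_self_pow₀ (by linarith) (by norm_num))
    have h7 : L ^ 25 = L * L ^ 24 := by ring
    nlinarith
  · rw [div_mul_eq_mul_div, div_le_one (by exact_mod_cast hk)]
    refine le_trans ?_ hk'
    calc (d : ℝ) * L ^ 23 ≤ L * L ^ 23 := by gcongr
      _ = L ^ 24 := by ring

/-- Since `exp (-ℓ) = L ^ (-60 d)` and `c² ≤ L ^ (50 d)`, each of the six net terms is at most
`L⁻¹⁰`, while `δ ≥ 1 / L` and `n ≤ L` give `δ / n ≥ L⁻²`. The sum is at most `6 / 16 + 1 / 4` of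
that. -/
lemma failure_probability_le {L δ n c ℓ e : ℝ} (hL : 4 ≤ L) (hd : 0 < d)
    (hn : 0 < n) (hδL : 1 ≤ L * δ) (hnL : n ≤ L) (hc0 : 0 ≤ c) (hc : c ≤ L ^ (25 * d))
    (hℓ : ℓ = 60 * (d * Real.log L)) (he : e ≤ 1 / L ^ 3) :
    3 * c ^ 2 * Real.exp (-ℓ) + 3 * c ^ 2 * Real.exp (-ℓ) + e ≤ δ / n := by
  have hL0 : 0 < L := by linarith
  have hexp : Real.exp (-ℓ) = (L ^ (60 * d))⁻¹ := by
    rw [hℓ, Real.exp_neg]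
    congr 1
    rw [← mul_assoc, ← Real.rpow_natCast, Real.rpow_def_of_pos hL0]
    push_cast
    ring_nf
  have h1 : c ^ 2 * Real.exp (-ℓ) ≤ (L ^ 10)⁻¹ := by
    rw [hexp, ← div_eq_mul_inv, div_le_iff₀ (by positivity)]
    have h2 : c ^ 2 ≤ L ^ (50 * d) := by
      calc c ^ 2 ≤ (L ^ (25 * d)) ^ 2 := by gcongr
        _ = L ^ (50 * d) := by rw [← pow_mul]; ring_nf
    refine h2.trans ?_
    rw [← div_eq_inv_mul, le_div_iff₀ (by positivity), ← pow_add]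
    exact pow_le_pow_right₀ (by linarith) (by omega)
  have h3 : δ / n ≥ 1 / L ^ 2 := by
    rw [ge_iff_le, div_le_div_iff₀ (by positivity) hn]
    nlinarith
  have h4 : (L ^ 10)⁻¹ ≤ 1 / 16 * (1 / L ^ 2) := by
    rw [← one_div, div_mul_div_comm, one_mul, div_le_div_iff₀ (by positivity) (by positivity),
      one_mul, one_mul]
    calc 16 * L ^ 2 ≤ L ^ 2 * L ^ 2 := by gcongr; nlinarith
      _ = L ^ 4 := by ring
      _ ≤ L ^ 10 := pow_le_pow_right₀ (by linarith) (by norm_num)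
  have h5 : 1 / L ^ 3 ≤ 1 / 4 * (1 / L ^ 2) := by
    rw [div_mul_div_comm, one_mul, div_le_div_iff₀ (by positivity) (by positivity), one_mul,
      one_mul]
    calc 4 * L ^ 2 ≤ L * L ^ 2 := by gcongr
      _ = L ^ 3 := by ring
  have h6 : 0 < 1 / L ^ 2 := by positivity
  linarith

end Polynomial

/-! ### From the model assumptions to one cluster -/

section Model

variable {d K M : ℕ} {I : Type*} {A W : Fin K → Matrix (Fin d) (Fin d) ℝ} {κA ρ Γmax Wmin κw : ℝ}

lemma ModelAssumptions.inner_act_self_le (h : ModelAssumptions A W κA ρ Γmax Wmin κw) (k : Fin K)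
    (u : State d) : ⟪u, act (W k) u⟫ ≤ Γmax * ‖u‖ ^ 2 := by
  have hs := summable_autocov (A := A k) (W := W k) h.one_le_κA h.ρ_nonneg h.ρ_lt_one (h.stable k)
  refine (inner_act_self_le_autocov (h.posDef k).posSemidef hs u).trans ?_
  refine (inner_act_self_le_lambdaMax (isHermitian_autocov (h.posDef k).isHermitian) u).trans ?_
  exact mul_le_mul_of_nonneg_right (h.autocov_le k) (sq_nonneg _)

lemma ModelAssumptions.lambdaMin_le_specNorm (hd : 0 < d)
    (h : ModelAssumptions A W κA ρ Γmax Wmin κw) (k : Fin K) :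
    lambdaMin (W k) ≤ specNorm (W k) := by
  have h1 := (lambdaMin_le_inner_act_self (h.posDef k).isHermitian
    (EuclideanSpace.single ⟨0, hd⟩ 1)).trans (inner_act_self_le_specNorm _ _)
  simpa using h1

lemma ModelAssumptions.specNorm_le (h : ModelAssumptions A W κA ρ Γmax Wmin κw) (hΓ : 0 ≤ Γmax)
    (k : Fin K) : specNorm (W k) ≤ Γmax := by
  refine specNorm_le_of_abs_inner_self_le (by
    simpa [Matrix.IsHermitian, Matrix.conjTranspose_eq_transpose_of_trivial]
      using (h.posDef k).isHermitian) hΓ fun u => ?_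
  rw [abs_of_nonneg (inner_act_self_nonneg (h.posDef k).posSemidef u)]
  exact h.inner_act_self_le k u

lemma ModelAssumptions.specNorm_le_mul (hd : 0 < d)
    (h : ModelAssumptions A W κA ρ Γmax Wmin κw) (k : Fin K) :
    specNorm (W k) ≤ κw * lambdaMin (W k) := by
  refine (specNorm_le_lambdaMax hd (h.posDef k).posSemidef).trans ?_
  exact (div_le_iff₀ (h.Wmin_pos.trans_le (h.Wmin_le k))).1 (h.cond_le k)

lemma le_mul_five_of_one_le {a b c e f : ℝ} (ha : 1 ≤ a) (hb : 1 ≤ b) (hc : 1 ≤ c) (he : 1 ≤ e)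
    (hf : 1 ≤ f) : a ≤ a * (b * c * e * f) := by
  refine le_mul_of_one_le_right (by linarith) ?_
  have h1 : 1 ≤ b * c := one_le_mul_of_one_le_of_one_le hb hc
  have h2 : 1 ≤ b * c * e := one_le_mul_of_one_le_of_one_le h1 he
  exact one_le_mul_of_one_le_of_one_le h2 hf

lemma ModelAssumptions.Wmin_le_Γmax (hd : 0 < d) (h : ModelAssumptions A W κA ρ Γmax Wmin κw)
    (k : Fin K) : Wmin ≤ Γmax := by
  have h1 := h.inner_act_self_le k (EuclideanSpace.single ⟨0, hd⟩ 1)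
  have h2 := lambdaMin_le_inner_act_self (h.posDef k).isHermitian
    (EuclideanSpace.single ⟨0, hd⟩ (1 : ℝ))
  have h3 := h2.trans h1
  simp only [PiLp.norm_single, norm_one, one_pow, mul_one] at h3
  exact (h.Wmin_le k).trans h3

/-- As `δ < 1` and all other factors of `L` are at least one, the logarithm is positive, so the
length condition excludes an empty cluster. This also limits the number of clusters in the final
union bound. -/
lemma cluster_nonempty (hd : 0 < d) (hM : 0 < M) (h : ModelAssumptions A W κA ρ Γmax Wmin κw)
    {T : Fin M → ℕ} (hT : ∀ m, 1 ≤ T m) {δ : ℝ} (hδ0 : 0 < δ) (hδ1 : δ < 1) (k : Fin K)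
    {C : Finset (Fin M)} {c : ℝ} (hc : 0 < c)
    (hlen : c * d * κw ^ 2 * logFactor d T κA Γmax Wmin δ ≤ (clusterLength T C : ℝ)) :
    C.Nonempty := by
  rw [Finset.nonempty_iff_ne_empty]
  rintro rfl
  have hn1 : (1 : ℝ) ≤ (∑ m, T m : ℕ) := by
    have : T ⟨0, hM⟩ ≤ ∑ m, T m := Finset.single_le_sum (fun _ _ => Nat.zero_le _)
      (Finset.mem_univ _)
    exact_mod_cast (hT ⟨0, hM⟩).trans this
  have hd1 : (1 : ℝ) ≤ d := by exact_mod_cast hd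
  have hΓ1 : 1 ≤ Γmax / Wmin := (one_le_div h.Wmin_pos).2 (h.Wmin_le_Γmax hd k)
  have hL : 1 < Γmax / Wmin * (d * κA * (∑ m, T m : ℕ) / δ) := by
    have h1 : 1 < δ⁻¹ := (one_lt_inv₀ hδ0).2 hδ1
    refine h1.trans_le ((le_mul_five_of_one_le h1.le hΓ1 hd1 h.one_le_κA hn1).trans (le_of_eq ?_))
    ring
  have hlog := Real.log_pos hL
  have hκw := h.one_le_κw
  simp only [clusterLength, Finset.sum_empty, Nat.cast_zero] at hlen
  have : 0 < c * d * κw ^ 2 * logFactor d T κA Γmax Wmin δ := by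
    rw [logFactor]; positivity
  linarith

/-- The quantities that enter the bounds for one cluster, compared with their common bound `L`. -/
structure ClusterScale (Wk : Matrix (Fin d) (Fin d) ℝ) (T : Fin M → ℕ) (C : Finset (Fin M))
    (κA Γmax κw s δ L : ℝ) : Prop where
  four_le : 4 ≤ L
  s_pos : 0 < s
  s_le : s ≤ specNorm Wk
  specNorm_le : specNorm Wk ≤ L * s
  Γmax_pos : 0 < Γmax
  Γmax_le : Γmax ≤ L * s
  one_le_κA : 1 ≤ κA
  κA_le : κA ≤ L
  dim_le : (d : ℝ) ≤ L
  total_le : ((∑ m, T m : ℕ) : ℝ) ≤ L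
  one_le_mul_δ : 1 ≤ L * δ
  one_le_κw : 1 ≤ κw
  four_le_length : (4 : ℝ) ≤ clusterLength T C
  length_le : (clusterLength T C : ℝ) ≤ (∑ m, T m : ℕ)
  one_le_log : 1 ≤ d * Real.log L
  log_le : d * Real.log L ≤ L ^ 2
  le_length : 620000 * (d * Real.log L) * κw ^ 2 ≤ clusterLength T C

/-- `L` is a product of five factors, each at least one, so it dominates each of them. A nonempty
cluster has length at least four, whence `L ≥ 4 > e` and `log L ≥ 1`. -/
lemma ModelAssumptions.clusterScale (hd : 0 < d) (h : ModelAssumptions A W κA ρ Γmax Wmin κw)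
    {T : Fin M → ℕ} {δ : ℝ} (hδ0 : 0 < δ) (hδ1 : δ < 1) (k : Fin K)
    {C : Finset (Fin M)} (hC : C.Nonempty) (hC4 : ∀ m ∈ C, 4 ≤ T m)
    (hlen : 620000 * d * κw ^ 2 * logFactor d T κA Γmax Wmin δ ≤ (clusterLength T C : ℝ)) :
    ClusterScale (W k) T C κA Γmax κw (lambdaMin (W k)) δ
      (Γmax / Wmin * (d * κA * (∑ m, T m : ℕ) / δ)) := by
  have hcn : (clusterLength T C : ℝ) ≤ (∑ m, T m : ℕ) := by
    rw [clusterLength]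
    exact_mod_cast Finset.sum_le_sum_of_subset (Finset.subset_univ C)
  have hc4 : (4 : ℝ) ≤ clusterLength T C := by
    obtain ⟨m, hm⟩ := hC
    have h1 : T m ≤ clusterLength T C := Finset.single_le_sum (fun _ _ => Nat.zero_le _) hm
    exact_mod_cast (hC4 m hm).trans h1
  rw [logFactor] at hlen
  generalize hn : ((∑ m, T m : ℕ) : ℝ) = n at *
  have hs0 : 0 < lambdaMin (W k) := h.Wmin_pos.trans_le (h.Wmin_le k)
  have hκA := h.one_le_κA
  have hWmin := h.Wmin_pos
  have hd1 : (1 : ℝ) ≤ d := by exact_mod_cast hd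
  have hn1 : 1 ≤ n := by linarith
  have hδi : 1 ≤ δ⁻¹ := (one_le_inv₀ hδ0).2 hδ1.le
  have hsΓ : Wmin ≤ Γmax := h.Wmin_le_Γmax hd k
  have hΓ0 : 0 < Γmax := hWmin.trans_le hsΓ
  have hΓ1 : 1 ≤ Γmax / Wmin := (one_le_div hWmin).2 hsΓ
  have hL_def : Γmax / Wmin * (d * κA * n / δ) = Γmax / Wmin * (d * κA * n * δ⁻¹) := by
    rw [div_eq_mul_inv _ δ]
  rw [hL_def] at hlen ⊢
  have hΓL' := le_mul_five_of_one_le hΓ1 hd1 hκA hn1 hδi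
  have hdL : (d : ℝ) ≤ Γmax / Wmin * (d * κA * n * δ⁻¹) :=
    (le_mul_five_of_one_le hd1 hΓ1 hκA hn1 hδi).trans (le_of_eq (by ring))
  have hκL : κA ≤ Γmax / Wmin * (d * κA * n * δ⁻¹) :=
    (le_mul_five_of_one_le hκA hΓ1 hd1 hn1 hδi).trans (le_of_eq (by ring))
  have hnL : n ≤ Γmax / Wmin * (d * κA * n * δ⁻¹) :=
    (le_mul_five_of_one_le hn1 hΓ1 hd1 hκA hδi).trans (le_of_eq (by ring))
  have hδL : δ⁻¹ ≤ Γmax / Wmin * (d * κA * n * δ⁻¹) :=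
    (le_mul_five_of_one_le hδi hΓ1 hd1 hκA hn1).trans (le_of_eq (by ring))
  generalize Γmax / Wmin * (d * κA * n * δ⁻¹) = L at *
  have hL : 4 ≤ L := by linarith
  have hL0 : 0 < L := by linarith
  have hΓL : Γmax ≤ L * lambdaMin (W k) := by
    rw [div_le_iff₀ hWmin] at hΓL'
    exact hΓL'.trans (mul_le_mul_of_nonneg_left (h.Wmin_le k) hL0.le)
  have hlog1 : 1 ≤ Real.log L := by
    rw [Real.le_log_iff_exp_le hL0]
    linarith [Real.exp_one_lt_d9]
  exact
    { four_le := hL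
      s_pos := hs0
      s_le := h.lambdaMin_le_specNorm hd k
      specNorm_le := (h.specNorm_le hΓ0.le k).trans hΓL
      Γmax_pos := hΓ0
      Γmax_le := hΓL
      one_le_κA := hκA
      κA_le := hκL
      dim_le := hdL
      total_le := by rw [hn]; exact hnL
      one_le_mul_δ := by rwa [← one_div, div_le_iff₀ hδ0] at hδL
      one_le_κw := h.one_le_κw
      four_le_length := hc4
      length_le := by rw [hn]; exact hcn
      one_le_log := one_le_mul_of_one_le_of_one_le hd1 hlog1
      log_le := by
        rw [pow_two]
        exact mul_le_mul hdL (by linarith [Real.log_le_sub_one_of_pos hL0]) (by linarith) hL0.le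
      le_length := le_trans (le_of_eq (by ring)) hlen }

lemma ClusterScale.log_le_length {Wk : Matrix (Fin d) (Fin d) ℝ} {T : Fin M → ℕ}
    {C : Finset (Fin M)} {s δ L : ℝ} (hsc : ClusterScale Wk T C κA Γmax κw s δ L) :
    620000 * (d * Real.log L) ≤ clusterLength T C := by
  refine le_trans (le_mul_of_one_le_right ?_ (one_le_pow₀ hsc.one_le_κw)) hsc.le_length
  have := hsc.one_le_log
  positivity

lemma ClusterScale.specNorm_pos {Wk : Matrix (Fin d) (Fin d) ℝ} {T : Fin M → ℕ}
    {C : Finset (Fin M)} {s δ L : ℝ} (hsc : ClusterScale Wk T C κA Γmax κw s δ L) :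
    0 < specNorm Wk := hsc.s_pos.trans_le hsc.s_le

lemma ClusterScale.le_card_clusterIndex {Wk : Matrix (Fin d) (Fin d) ℝ} {T : Fin M → ℕ}
    {C : Finset (Fin M)} {s δ L : ℝ} (hsc : ClusterScale Wk T C κA Γmax κw s δ L) :
    60 * (d * Real.log L) ≤ (clusterIndex T C).card := by
  rw [card_clusterIndex]
  linarith [hsc.log_le_length, hsc.one_le_log]

lemma ClusterScale.le_card_innerIndex {Wk : Matrix (Fin d) (Fin d) ℝ} {T : Fin M → ℕ}
    {C : Finset (Fin M)} {s δ L : ℝ} (hsc : ClusterScale Wk T C κA Γmax κw s δ L)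
    (hC4 : ∀ m ∈ C, 4 ≤ T m) :
    60 * (d * Real.log L) ≤ (innerIndex T C).card := by
  linarith [hsc.log_le_length, hsc.one_le_log, card_innerIndex_ge hC4]

/-- The step size in the Chernoff bound for the empirical noise covariance. -/
noncomputable def chernoffStep (ℓ τ : ℝ) (t : Finset I) : ℝ := √(ℓ / t.card) / (4 * τ)

lemma chernoffStep_nonneg (ℓ : ℝ) {τ : ℝ} (hτ : 0 < τ) (t : Finset I) :
    0 ≤ chernoffStep ℓ τ t := by
  rw [chernoffStep]; positivity

lemma chernoffStep_mul_le {ℓ τ : ℝ} (hτ : 0 < τ) {t : Finset I} (ht : ℓ ≤ t.card) :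
    chernoffStep ℓ τ t * τ ≤ 1 / 4 := by
  have h1 : √(ℓ / t.card) ≤ 1 := Real.sqrt_le_one.2 (div_le_one_of_le₀ ht (Nat.cast_nonneg _))
  have h2 : chernoffStep ℓ τ t * τ = √(ℓ / t.card) / 4 := by rw [chernoffStep]; field_simp
  rw [h2]; linarith

lemma card_noiseIndex (T : Fin M → ℕ) :
    (Fintype.card ((m : Fin M) × Fin (T m)) : ℝ) = (∑ m, T m : ℕ) := by
  rw [Fintype.card_sigma]; simp

/-- A polynomial bound for the energy of the states in terms of the energy of the noise. -/
lemma sum_norm_state_sq_le {T : Fin M → ℕ} {v : ((m : Fin M) × Fin (T m)) → State d}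
    {y : ((m : Fin M) × Fin (T m)) → State d} {L s : ℝ} (hL : 4 ≤ L) (hs : 0 ≤ s) (hκ : 1 ≤ κA)
    (hκL : κA ≤ L) (hn : ((∑ m, T m : ℕ) : ℝ) ≤ L)
    (hy : ∀ p, ‖y p‖ ≤ 2 * κA ^ 2 * ∑ q, ‖v q‖) (hv : ∑ q, ‖v q‖ ^ 2 ≤ L ^ 6 * s)
    (t : Finset ((m : Fin M) × Fin (T m))) : ∑ p ∈ t, ‖y p‖ ^ 2 ≤ L ^ 13 * s := by
  have hL0 : 0 < L := by linarith
  have hsq : (∑ q, ‖v q‖) ^ 2 ≤ L * (L ^ 6 * s) := by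
    refine sq_sum_le_card_mul_sum_sq.trans ?_
    rw [Finset.card_univ, card_noiseIndex]
    gcongr
  have hy2 : ∀ p, ‖y p‖ ^ 2 ≤ L ^ 12 * s := by
    intro p
    calc ‖y p‖ ^ 2 ≤ (2 * κA ^ 2 * ∑ q, ‖v q‖) ^ 2 := by
          gcongr
          exact hy p
      _ = 4 * κA ^ 4 * (∑ q, ‖v q‖) ^ 2 := by ring
      _ ≤ L * L ^ 4 * (L * (L ^ 6 * s)) := by gcongr
      _ = L ^ 12 * s := by ring
  refine (Finset.sum_le_card_nsmul t _ _ fun p _ => hy2 p).trans ?_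
  rw [nsmul_eq_mul]
  have ht : (t.card : ℝ) ≤ L := by
    refine le_trans ?_ hn
    rw [← card_noiseIndex]
    exact_mod_cast Finset.card_le_univ t
  calc (t.card : ℝ) * (L ^ 12 * s) ≤ L * (L ^ 12 * s) := by gcongr
    _ = _ := by ring

/-- The estimation bounds on the event that the noise is controlled on a fine net. -/
lemma estimation_bounds_of_netControl {Ak Wk : Matrix (Fin d) (Fin d) ℝ} {T : Fin M → ℕ}
    {C : Finset (Fin M)} {s δ L ε : ℝ} (hsc : ClusterScale Wk T C κA Γmax κw s δ L)
    {y v : Fin M → ℕ → State d} (hdyn : ∀ m ∈ C, ∀ t < T m, y m (t + 1) = act Ak (y m t) + v m t)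
    (hC4 : ∀ m ∈ C, 4 ≤ T m) (hA : specNorm Ak ≤ κA)
    (hW : ∀ u : State d, s * ‖u‖ ^ 2 ≤ ⟪u, act Wk u⟫) (hWt : Wk.transpose = Wk)
    (hκw : specNorm Wk ≤ κw * s) {N : Finset (State d)} (hN : ∀ u ∈ N, ‖u‖ ≤ 1)
    (hcover : ∀ u : State d, ‖u‖ ≤ 1 → ∃ v ∈ N, ‖u - v‖ ≤ ε) (hε : 0 ≤ ε) (hεL : ε * L ^ 23 ≤ 1)
    (hy : ∀ p : (m : Fin M) × Fin (T m),
      ‖y p.1 p.2‖ ≤ 2 * κA ^ 2 * ∑ q : (m : Fin M) × Fin (T m), ‖v q.1 q.2‖)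
    (hv : ∑ q : (m : Fin M) × Fin (T m), ‖v q.1 q.2‖ ^ 2 ≤ L ^ 6 * s)
    (h : NetControl N (clusterIndex T C) Wk (fun p => v p.1 p.2) (fun p => y p.1 p.2) (L ^ 4 / s)
      (chernoffStep (60 * (d * Real.log L)) (specNorm Wk) (clusterIndex T C))
      (60 * (d * Real.log L)))
    (h' : NetControl N (innerIndex T C) Wk (fun p => v p.1 p.2) (fun p => y p.1 p.2) (L ^ 4 / s)
      (chernoffStep (60 * (d * Real.log L)) (specNorm Wk) (innerIndex T C))
      (60 * (d * Real.log L))) :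
    IsUnit (gram T y C) ∧
      specNorm (estA T y C - Ak) ≤ 32 * √(d * Real.log L * κw / clusterLength T C) ∧
      specNorm (estW T y C - Wk) / specNorm Wk ≤ 80 * √(d * Real.log L / clusterLength T C) := by
  have hxsum := sum_norm_state_sq_le (v := fun q => v q.1 q.2) (y := fun q => y q.1 q.2)
    hsc.four_le hsc.s_pos.le hsc.one_le_κA hsc.κA_le hsc.total_le hy hv
  have hwsum : ∀ t : Finset ((m : Fin M) × Fin (T m)), ∑ p ∈ t, ‖v p.1 p.2‖ ^ 2 ≤ L ^ 6 * s :=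
    fun t => (Finset.sum_le_sum_of_subset_of_nonneg (Finset.subset_univ t)
      fun _ _ _ => sq_nonneg _).trans hv
  have hL := hsc.four_le
  have hD1 := hsc.one_le_log
  have hlength := hsc.length_le.trans hsc.total_le
  have hΛL : 2 * (62 * (d * Real.log L)) ≤ L ^ 6 := by
    calc 2 * (62 * (d * Real.log L)) ≤ 4 ^ 4 * L ^ 2 := by
          linarith [hsc.log_le, sq_nonneg L]
      _ ≤ L ^ 4 * L ^ 2 := by gcongr
      _ = L ^ 6 := by ring
  have hNC := h.noiseControl_of_poly (κ := κA) (Λ := 62 * (d * Real.log L)) hN hcover hL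
    hsc.s_pos hsc.s_le hsc.specNorm_le hsc.one_le_κA hsc.κA_le (by linarith)
    hsc.le_card_clusterIndex (by rw [card_clusterIndex]; exact hlength) (by linarith) hΛL hε hεL
    (hwsum _) (hxsum _)
  have hNC' := h'.noiseControl_of_poly (κ := κA) (Λ := 62 * (d * Real.log L)) hN hcover hL
    hsc.s_pos hsc.s_le hsc.specNorm_le hsc.one_le_κA hsc.κA_le (by linarith)
    (hsc.le_card_innerIndex hC4) ((card_innerIndex_le T C).trans hlength) (by linarith) hΛL hε hεL
    (hwsum _) (hxsum _)
  exact estimation_bounds hdyn hC4 hsc.four_le_length hsc.one_le_κA hA hsc.s_pos hW hWt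
    hsc.specNorm_pos hsc.one_le_κw hκw (by positivity) le_rfl hsc.le_length hNC hNC'

/-- The failure probability of the estimation bounds for a single cluster. -/
lemma measure_not_estimation_le (hd : 0 < d) (h : ModelAssumptions A W κA ρ Γmax Wmin κw)
    {label : Fin M → Fin K} {T : Fin M → ℕ} (hT : ∀ m, 1 ≤ T m)
    {Ω : Type*} [MeasurableSpace Ω] {P : Measure Ω} [IsProbabilityMeasure P]
    {w x : Fin M → ℕ → Ω → State d} (hx : IsMixedLDS A W label T P w x)
    (hstart : StartsAtZero x ∨ (IsSegmented T x ∧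
      ∀ m, 1 / (1 - ρ) * Real.log (Real.sqrt 2 * κA) ≤ (T m : ℝ)))
    (k : Fin K) {C : Finset (Fin M)} {δ L : ℝ} (hC4 : ∀ m ∈ C, 4 ≤ T m)
    (hlabel : ∀ m ∈ C, label m = k)
    (hsc : ClusterScale (W k) T C κA Γmax κw (lambdaMin (W k)) δ L) :
    P {ω | ¬ (IsUnit (gram T (fun m t => x m t ω) C) ∧
      specNorm (estA T (fun m t => x m t ω) C - A k)
        ≤ 32 * √(d * Real.log L * κw / clusterLength T C) ∧
      specNorm (estW T (fun m t => x m t ω) C - W k) / specNorm (W k)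
        ≤ 80 * √(d * Real.log L / clusterLength T C))} ≤
      ENNReal.ofReal (δ / (∑ m, T m : ℕ)) := by
  have hL := hsc.four_le
  have hL0 : 0 < L := by linarith
  have hs0 := hsc.s_pos
  obtain ⟨N, ε, hN1, hcover, hNcard, hε0, hεL⟩ := exists_fine_net (d := d) hL hsc.dim_le
  obtain ⟨F, hFm, hFdep, hFx⟩ := exists_predictable hx.dynamics (hstart.imp id fun h => h.1)
  obtain ⟨hmeas, hlaw⟩ := hx.map_noise
  have hSW : ∀ p ∈ clusterIndex T C, W (label p.1) = W k := fun p hp => by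
    rw [hlabel p.1 (Finset.mem_sigma.1 hp).1]
  have hpsd : ∀ p : (m : Fin M) × Fin (T m), (W (label p.1)).PosSemidef :=
    fun p => (h.posDef _).posSemidef
  have hB1 := measure_not_netControl_le (fun p => W (label p.1)) hpsd timeKey
    timeKey_injective F hFm hFdep (clusterIndex T C) hSW hN1 (L ^ 4 / lambdaMin (W k))
    (60 * (d * Real.log L)) (chernoffStep_nonneg _ hsc.specNorm_pos _)
    (chernoffStep_mul_le hsc.specNorm_pos hsc.le_card_clusterIndex)
  have hB2 := measure_not_netControl_le (fun p => W (label p.1)) hpsd timeKey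
    timeKey_injective F hFm hFdep (innerIndex T C)
    (fun p hp => hSW p (innerIndex_subset T C hp)) hN1 (L ^ 4 / lambdaMin (W k))
    (60 * (d * Real.log L)) (chernoffStep_nonneg _ hsc.specNorm_pos _)
    (chernoffStep_mul_le hsc.specNorm_pos (hsc.le_card_innerIndex hC4))
  have hB3 := measure_energy_le (fun p : (m : Fin M) × Fin (T m) => W (label p.1)) hpsd
    (γ := Γmax) (fun p u hu => (h.inner_act_self_le _ u).trans
      (mul_le_of_le_one_right hsc.Γmax_pos.le (pow_le_one₀ (norm_nonneg _) hu)))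
    (show 0 < L ^ 6 * lambdaMin (W k) by positivity)
  have hB := (measure_union_le _ _).trans (add_le_add hB1 ((measure_union_le _ _).trans
    (add_le_add hB2 hB3)))
  have hcardI := card_noiseIndex T
  have hn0 : (0 : ℝ) < (∑ m, T m : ℕ) := by linarith [hsc.length_le, hsc.four_le_length]
  -- Total length, dimension and `Γmax / s` are each at most `L`, so noise energy above `L ^ 6 * s`
  -- has probability at most `L⁻³`.
  have he : Fintype.card ((m : Fin M) × Fin (T m)) * (d * Γmax) / (L ^ 6 * lambdaMin (W k)) ≤
      1 / L ^ 3 := by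
    rw [hcardI]
    calc ((∑ m, T m : ℕ) : ℝ) * (d * Γmax) / (L ^ 6 * lambdaMin (W k))
        ≤ L * (L * (L * lambdaMin (W k))) / (L ^ 6 * lambdaMin (W k)) := by
          have := hsc.total_le
          have := hsc.dim_le
          have := hsc.Γmax_le
          have := hsc.Γmax_pos
          gcongr
      _ = 1 / L ^ 3 := by field_simp
  have hprob := failure_probability_le hL hd hn0 hsc.one_le_mul_δ hsc.total_le
    (Nat.cast_nonneg _) hNcard rfl he
  have hΓ0 := hsc.Γmax_pos
  rw [← ENNReal.ofReal_add (by positivity) (by positivity), ← ENNReal.ofReal_add (by positivity)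
    (by positivity), ← add_assoc, ← hlaw] at hB
  -- Passing to the law of the noise by an inequality avoids any measurability of the bad event.
  refine le_trans (measure_mono ?_) ((Measure.le_map_apply hmeas _).trans
    (hB.trans (ENNReal.ofReal_le_ofReal hprob)))
  intro ω hω
  by_contra hno
  refine hω ?_
  simp only [Set.mem_preimage, Set.mem_union, not_or, Set.mem_ofPred_eq, not_not,
    not_le, ← hFx] at hno
  obtain ⟨hc1, hc2, hw⟩ := hno
  have hA1 : specNorm (A k) ≤ κA := by
    have h1 := h.stable k 1 le_rfl
    rw [pow_one, pow_one] at h1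
    exact h1.trans (mul_le_of_le_one_right (by linarith [hsc.one_le_κA]) h.ρ_lt_one.le)
  exact estimation_bounds_of_netControl hsc (y := fun m t => x m t ω) (v := fun m t => w m t ω)
    (fun m hm t ht => by rw [← hlabel m hm]; exact hx.dynamics m t ht ω) hC4 hA1
    (lambdaMin_le_inner_act_self (h.posDef k).isHermitian)
    (by simpa [Matrix.IsHermitian, Matrix.conjTranspose_eq_transpose_of_trivial]
      using (h.posDef k).isHermitian) (h.specNorm_le_mul hd k) hN1 hcover hε0 hεL
    (fun p => norm_state_le hsc.one_le_κA h.ρ_nonneg h.ρ_lt_one h.stable hT hx.dynamics hstart ω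
      p.1 p.2.2.le) hw.le hc1 hc2

end Model

end MixedLDS

/-! ### Union bound over the clusters -/

theorem theorem5 :
    ∃ C₁ C₂ C₃ : ℝ, 0 < C₁ ∧ 0 < C₂ ∧ 0 < C₃ ∧
    ∀ (d K M : ℕ), 0 < d → 0 < M →
    ∀ (A W : Fin K → Matrix (Fin d) (Fin d) ℝ) (κA ρ Γmax Wmin κw : ℝ),
    MixedLDS.ModelAssumptions A W κA ρ Γmax Wmin κw →
    ∀ (label : Fin M → Fin K) (T : Fin M → ℕ), (∀ m, 1 ≤ T m) →
    ∀ (Ω : Type*) [MeasurableSpace Ω] (P : MeasureTheory.Measure Ω)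
      [MeasureTheory.IsProbabilityMeasure P] (w x : Fin M → ℕ → Ω → MixedLDS.State d),
    MixedLDS.IsMixedLDS A W label T P w x →
    (MixedLDS.StartsAtZero x ∨
      (MixedLDS.IsSegmented T x ∧
        ∀ m, 1 / (1 - ρ) * Real.log (Real.sqrt 2 * κA) ≤ (T m : ℝ))) →
    ∀ (δ : ℝ), 0 < δ → δ < 1 →
    ∀ (Mclustering Mclassification : Finset (Fin M)),
    (∀ m ∈ Mclustering ∪ Mclassification, 4 ≤ T m) →
    ∀ (C : Fin K → Finset (Fin M)),
    (∀ k, C k ⊆ Mclustering ∪ Mclassification) →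
    (∀ k, ∀ m ∈ C k, label m = k) →
    (∀ k, C₁ * d * κw ^ 2 * MixedLDS.logFactor d T κA Γmax Wmin δ
      ≤ (MixedLDS.clusterLength T (C k) : ℝ)) →
    ENNReal.ofReal (1 - δ) ≤ P {ω | ∀ k,
      IsUnit (MixedLDS.gram T (fun m t => x m t ω) (C k)) ∧
      MixedLDS.specNorm (MixedLDS.estA T (fun m t => x m t ω) (C k) - A k)
        ≤ C₂ * Real.sqrt (d * κw * MixedLDS.logFactor d T κA Γmax Wmin δ
            / MixedLDS.clusterLength T (C k)) ∧
      MixedLDS.specNorm (MixedLDS.estW T (fun m t => x m t ω) (C k) - W k)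
          / MixedLDS.specNorm (W k)
        ≤ C₃ * Real.sqrt (d * MixedLDS.logFactor d T κA Γmax Wmin δ
            / MixedLDS.clusterLength T (C k))} := by
  refine ⟨620000, 32, 80, by norm_num, by norm_num, by norm_num, ?_⟩
  intro d K M hd hM A W κA ρ Γmax Wmin κw h label T hT Ω _ P _ w x hx hstart δ hδ0 hδ1
    M₁ M₂ hM4 C hCsub hlabel hlen
  have hne : ∀ k, (C k).Nonempty := fun k =>
    MixedLDS.cluster_nonempty hd hM h hT hδ0 hδ1 k (by norm_num) (hlen k)
  -- Pure nonempty clusters are disjoint, so choosing a member of each is injective. Hence `K ≤ M`,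
  -- and failure `δ / T_total` per cluster adds up to at most `δ`.
  have hKn : (K : ℝ) ≤ (∑ m, T m : ℕ) := by
    choose f hf using hne
    have hinj : Function.Injective f := fun i j hij => by
      rw [← hlabel i _ (hf i), hij, hlabel j _ (hf j)]
    have h1 : K ≤ M := by simpa using Fintype.card_le_of_injective f hinj
    have h2 : M ≤ ∑ m, T m := by
      calc M = ∑ _m : Fin M, 1 := by simp
        _ ≤ _ := Finset.sum_le_sum fun m _ => hT m
    exact_mod_cast h1.trans h2
  have hn0 : (0 : ℝ) < (∑ m, T m : ℕ) := by
    have : T ⟨0, hM⟩ ≤ ∑ m, T m := Finset.single_le_sum (fun _ _ => Nat.zero_le _)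
      (Finset.mem_univ _)
    exact_mod_cast (hT ⟨0, hM⟩).trans this
  have hk := fun k => MixedLDS.measure_not_estimation_le hd h hT hx hstart k
    (fun m hm => hM4 m (hCsub k hm)) (hlabel k) (h.clusterScale hd hδ0 hδ1 k (hne k)
      (fun m hm => hM4 m (hCsub k hm)) (hlen k))
  have hbad := (MeasureTheory.measure_iUnion_fintype_le P _).trans
    (Finset.sum_le_sum fun k _ => hk k)
  rw [Finset.sum_const, Finset.card_univ, Fintype.card_fin, nsmul_eq_mul,
    ← ENNReal.ofReal_natCast, ← ENNReal.ofReal_mul (Nat.cast_nonneg _)] at hbad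
  have hδ : (K : ℝ) * (δ / (∑ m, T m : ℕ)) ≤ δ := by
    rw [mul_div_assoc', div_le_iff₀ hn0, mul_comm]
    gcongr
  have hbad' := hbad.trans (ENNReal.ofReal_le_ofReal hδ)
  -- Subadditivity, in the form that one is at most the measure of the good event plus that of the
  -- bad one, needs no measurability.
  rw [ENNReal.ofReal_sub _ hδ0.le, ENNReal.ofReal_one, tsub_le_iff_right,
    ← MeasureTheory.measure_univ (μ := P)]
  refine le_trans ?_ (add_le_add_right hbad' _)
  refine le_trans (MeasureTheory.measure_mono fun ω _ => ?_) (MeasureTheory.measure_union_le _ _)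
  refine or_iff_not_imp_left.2 fun hω => ?_
  obtain ⟨k, hk⟩ := not_forall.1 hω
  refine Set.mem_iUnion.2 ⟨k, fun hest => hk ⟨hest.1, ?_, hest.2.2⟩⟩
  rw [mul_right_comm (d : ℝ)]
  exact hest.2.1
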